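/- Let $\mathbb H(\mathbb C)$ be the algebra of complex quaternions $q=q_0+q_1i_1+q_2i_2+q_3i_3$ ($q_k\in\mathbb C$), with $\mathbb C^3$ identified with the purely vectorial ones. Let $\Omega\subseteq\mathbb R^3$ be open, $Df=\sum_{k=1}^3 i_k\,\partial_k f$, $M^{\alpha}f=f\alpha$, and let $\delta$ be the Dirac distribution at the origin, restricted to $\Omega$. A distribution $\psi$ (scalar), resp. $f$ ($\mathbb H(\mathbb C)$-valued), on $\Omega$ is called a fundamental solution of $-\Delta+v$, resp. of $D+M^\alpha$, in $\Omega$ if $(-\Delta+v)\psi=\delta$, resp. $(D+M^\alpha)f=\delta$, in the sense of distributions on $\Omega$. (1) Let $n\in\{0,1,2,\dots,\infty\}$, let $\varphi:\Omega\to\mathbb C$ be of class $C^{n+2}$ and nowhere zero, and put $\alpha=\operatorname{grad}\varphi/\varphi$, $v=\Delta\varphi/\varphi$. If a scalar distribution $\psi$ of order at most $n$ on $\Omega$ is a fundamental solution of $-\Delta+v$, then $(D-\alpha)\psi$ is a fundamental solution of $D+M^{\alpha}$ in $\Omega$. (For $n=0$ this covers all locally integrable functions $\psi$.) (2) For every $c\in\mathbb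 C$ the function $\psi(x)=\dfrac{e^{ic|x|}}{4\pi|x|}$ is locally integrable on $\Omega$ and is a fundamental solution of $-\Delta-c^2$ in $\Omega$. (3) Let $c\in\mathbb C$ and let $\varphi:\Omega\to\mathbb C$ be of class $C^2$, nowhere zero, with $\Delta\varphi/\varphi=-c^2$ in $\Omega$; put $\alpha=\operatorname{grad}\varphi/\varphi$. Then, with $\psi$ as in (2) and $x=\sum_k x_ki_k$, $$f(x)=\Bigl(D-\frac{\operatorname{grad}\varphi(x)}{\varphi(x)}\Bigr)\frac{e^{ic|x|}}{4\pi|x|}=\Bigl(-\frac{x}{|x|^2}+ic\,\frac{x}{|x|}-\frac{\operatorname{grad}\varphi(x)}{\varphi(x)}\Bigr)\frac{e^{ic|x|}}{4\pi|x|}\qquad(x\in\Omega,\ x\neq0),$$ the function $f$ is locally integrable on $\Omega$, the identity $f=(D-\alpha)\psi$ also holds in the sense of distributions on $\Omega$, and $f$ is a fundamental solution of $D+M^{\alpha}$ in $\Omega$. -/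

import Mathlib

open MeasureTheory TopologicalSpace
open scoped Quaternion Distributions Laplacian CompactConvergenceCLM ContDiff

noncomputable section

/-! ### Biquaternions

`ℍ[ℂ]` is the algebra of complex quaternions `q = q₀ + q₁ i₁ + q₂ i₂ + q₃ i₃` with `qₖ ∈ ℂ`. It is
finite dimensional; we give it its usual topology, through the norm `∑ |qₖ|`. -/

namespace Biquaternion

theorem norm_sub₄ (a b c d : ℂ) : ‖a - b - c - d‖ ≤ ‖a‖ + ‖b‖ + ‖c‖ + ‖d‖ :=
  (norm_sub_le _ _).trans (add_le_add_left ((norm_sub_le _ _).trans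
    (add_le_add_left (norm_sub_le _ _) _)) _)

instance : NormedRing ℍ[ℂ] where
  toRing := Quaternion.instRing
  norm q := ‖q.re‖ + ‖q.imI‖ + ‖q.imJ‖ + ‖q.imK‖
  dist p q := ‖(-p + q).re‖ + ‖(-p + q).imI‖ + ‖(-p + q).imJ‖ + ‖(-p + q).imK‖
  dist_eq _ _ := rfl
  dist_self p := by simp
  dist_comm p q := by
    rw [neg_add_eq_sub, neg_add_eq_sub]
    change ‖q.re - p.re‖ + ‖q.imI - p.imI‖ + ‖q.imJ - p.imJ‖ + ‖q.imK - p.imK‖ =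
      ‖p.re - q.re‖ + ‖p.imI - q.imI‖ + ‖p.imJ - q.imJ‖ + ‖p.imK - q.imK‖
    rw [norm_sub_rev, norm_sub_rev q.imI, norm_sub_rev q.imJ, norm_sub_rev q.imK]
  dist_triangle p q r := by
    rw [neg_add_eq_sub, neg_add_eq_sub, neg_add_eq_sub]
    change ‖r.re - p.re‖ + ‖r.imI - p.imI‖ + ‖r.imJ - p.imJ‖ + ‖r.imK - p.imK‖ ≤
      (‖q.re - p.re‖ + ‖q.imI - p.imI‖ + ‖q.imJ - p.imJ‖ + ‖q.imK - p.imK‖) +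
      (‖r.re - q.re‖ + ‖r.imI - q.imI‖ + ‖r.imJ - q.imJ‖ + ‖r.imK - q.imK‖)
    linarith [norm_sub_le_norm_sub_add_norm_sub r.re q.re p.re,
      norm_sub_le_norm_sub_add_norm_sub r.imI q.imI p.imI,
      norm_sub_le_norm_sub_add_norm_sub r.imJ q.imJ p.imJ,
      norm_sub_le_norm_sub_add_norm_sub r.imK q.imK p.imK]
  eq_of_dist_eq_zero {p q} h := by
    rw [neg_add_eq_sub] at h
    change ‖q.re - p.re‖ + ‖q.imI - p.imI‖ + ‖q.imJ - p.imJ‖ + ‖q.imK - p.imK‖ = 0 at h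
    have h0 := norm_nonneg (q.re - p.re)
    have h1 := norm_nonneg (q.imI - p.imI)
    have h2 := norm_nonneg (q.imJ - p.imJ)
    have h3 := norm_nonneg (q.imK - p.imK)
    refine Quaternion.ext _ _ ?_ ?_ ?_ ?_
    · exact (sub_eq_zero.1 (norm_eq_zero.1 (by linarith))).symm
    · exact (sub_eq_zero.1 (norm_eq_zero.1 (by linarith))).symm
    · exact (sub_eq_zero.1 (norm_eq_zero.1 (by linarith))).symm
    · exact (sub_eq_zero.1 (norm_eq_zero.1 (by linarith))).symm
  norm_mul_le p q := by
    have h0 : ‖(p * q).re‖ ≤ ‖p.re‖ * ‖q.re‖ + ‖p.imI‖ * ‖q.imI‖ + ‖p.imJ‖ * ‖q.imJ‖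
        + ‖p.imK‖ * ‖q.imK‖ := by
      rw [Quaternion.re_mul]
      simpa only [norm_mul] using norm_sub₄ (p.re * q.re) (p.imI * q.imI) (p.imJ * q.imJ)
        (p.imK * q.imK)
    have h1 : ‖(p * q).imI‖ ≤ ‖p.re‖ * ‖q.imI‖ + ‖p.imI‖ * ‖q.re‖ + ‖p.imJ‖ * ‖q.imK‖
        + ‖p.imK‖ * ‖q.imJ‖ := by
      rw [Quaternion.imI_mul]
      simpa [norm_mul] using norm_sub₄ (p.re * q.imI) (-(p.imI * q.re)) (-(p.imJ * q.imK))
        (p.imK * q.imJ)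
    have h2 : ‖(p * q).imJ‖ ≤ ‖p.re‖ * ‖q.imJ‖ + ‖p.imI‖ * ‖q.imK‖ + ‖p.imJ‖ * ‖q.re‖
        + ‖p.imK‖ * ‖q.imI‖ := by
      rw [Quaternion.imJ_mul]
      simpa [norm_mul] using norm_sub₄ (p.re * q.imJ) (p.imI * q.imK) (-(p.imJ * q.re))
        (-(p.imK * q.imI))
    have h3 : ‖(p * q).imK‖ ≤ ‖p.re‖ * ‖q.imK‖ + ‖p.imI‖ * ‖q.imJ‖ + ‖p.imJ‖ * ‖q.imI‖
        + ‖p.imK‖ * ‖q.re‖ := by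
      rw [Quaternion.imK_mul]
      simpa [norm_mul] using norm_sub₄ (p.re * q.imK) (-(p.imI * q.imJ)) (p.imJ * q.imI)
        (-(p.imK * q.re))
    change ‖(p * q).re‖ + ‖(p * q).imI‖ + ‖(p * q).imJ‖ + ‖(p * q).imK‖ ≤
      (‖p.re‖ + ‖p.imI‖ + ‖p.imJ‖ + ‖p.imK‖) * (‖q.re‖ + ‖q.imI‖ + ‖q.imJ‖ + ‖q.imK‖)
    linarith

theorem norm_def (q : ℍ[ℂ]) : ‖q‖ = ‖q.re‖ + ‖q.imI‖ + ‖q.imJ‖ + ‖q.imK‖ := rfl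

instance : NormedAlgebra ℂ ℍ[ℂ] where
  toAlgebra := Quaternion.algebra
  norm_smul_le c q := by
    simp only [norm_def, Quaternion.re_smul, Quaternion.imI_smul, Quaternion.imJ_smul,
      Quaternion.imK_smul, norm_smul, mul_add, le_refl]

instance : NormedAlgebra ℝ ℍ[ℂ] where
  toAlgebra := Quaternion.algebra
  norm_smul_le c q := by
    simp only [norm_def, Quaternion.re_smul, Quaternion.imI_smul, Quaternion.imJ_smul,
      Quaternion.imK_smul, norm_smul, mul_add, le_refl]

instance : Module ℝ ℍ[ℂ] := NormedSpace.toModule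

instance : Module ℂ ℍ[ℂ] := NormedSpace.toModule

instance : FiniteDimensional ℝ ℍ[ℂ] := Module.Finite.trans ℂ ℍ[ℂ]

/-- The embedding `ℂ → ℍ[ℂ]` of the scalars. -/
def scalar : ℂ →L[ℝ] ℍ[ℂ] := (algebraMapCLM ℂ ℍ[ℂ]).restrictScalars ℝ

/-- The identification of `ℂ³` with the purely vectorial biquaternions. -/
def vec (a : Fin 3 → ℂ) : ℍ[ℂ] := ⟨0, a 0, a 1, a 2⟩

/-- The imaginary units `i₁, i₂, i₃` (indexed by `0, 1, 2`). -/
def unit (k : Fin 3) : ℍ[ℂ] := vec (Pi.single k 1)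

/-- `q ↦ p * q` as a continuous linear map. -/
def mulLeft (p : ℍ[ℂ]) : ℍ[ℂ] →L[ℝ] ℍ[ℂ] := ContinuousLinearMap.mul ℝ ℍ[ℂ] p

/-- `q ↦ q * p` as a continuous linear map. -/
def mulRight (p : ℍ[ℂ]) : ℍ[ℂ] →L[ℝ] ℍ[ℂ] := (ContinuousLinearMap.mul ℝ ℍ[ℂ]).flip p

end Biquaternion

open Biquaternion

/-! ### Functions on `ℝ³` -/

/-- Euclidean three-space. -/
abbrev E3 : Type := EuclideanSpace ℝ (Fin 3)

/-- The standard basis of `ℝ³`. -/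
def stdVec (k : Fin 3) : E3 := EuclideanSpace.single k 1

/-- The Moisil-Theodoresco operator `D f = ∑ₖ iₖ ∂ₖ f` on functions. -/
def moisilTheodoresco (f : E3 → ℍ[ℂ]) (x : E3) : ℍ[ℂ] :=
  ∑ k : Fin 3, unit k * fderiv ℝ f x (stdVec k)

/-- The gradient of a complex-valued function, as a vectorial biquaternion. -/
def gradQ (φ : E3 → ℂ) (x : E3) : ℍ[ℂ] := vec fun k => fderiv ℝ φ x (stdVec k)

/-- `α = (grad φ) / φ`. -/
def logGrad (φ : E3 → ℂ) (x : E3) : ℍ[ℂ] := (φ x)⁻¹ • gradQ φ x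

/-- The point `x` of `ℝ³` as the biquaternion `x₁ i₁ + x₂ i₂ + x₃ i₃`. -/
def posQ (x : E3) : ℍ[ℂ] := vec fun k => (x k : ℂ)

/-- `ψ(x) = e^{ic|x|} / (4π|x|)`. -/
def helmholtzKernel (c : ℂ) (x : E3) : ℂ :=
  Complex.exp (Complex.I * c * ‖x‖) / (4 * Real.pi * ‖x‖)

/-- The explicit function `(- x/|x|² + i c x/|x| - (grad φ)/φ) · e^{ic|x|} / (4π|x|)`. -/
def explicitKernel (c : ℂ) (φ : E3 → ℂ) (x : E3) : ℍ[ℂ] :=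
  (-(((‖x‖ : ℂ) ^ 2)⁻¹ • posQ x) + (Complex.I * c * (‖x‖ : ℂ)⁻¹) • posQ x - logGrad φ x)
    * scalar (helmholtzKernel c x)

/-! ### Products of distributions with functions

Mathlib's `𝓓'^{n}(Ω, F)` is the space of `F`-valued distributions of order at most `n` on `Ω`
(continuous linear maps on the compactly supported `C^n` functions), and `𝓓'(Ω, F)` is the case
`n = ∞`. A distribution of order at most `n` can be multiplied by a `C^n` function. -/

section Products

variable {E : Type*} [NormedAddCommGroup E] [NormedSpace ℝ E] {Ω : Opens E} {n m : ℕ∞}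

theorem contDiff_mul_testFunction {g : E → ℝ} (hg : ContDiffOn ℝ n g Ω) (η : 𝓓^{n}(Ω, ℝ)) :
    ContDiff ℝ n fun x => g x * η x := by
  rw [contDiff_iff_contDiffAt]
  intro x
  by_cases hx : x ∈ tsupport η
  · exact (hg.contDiffAt (Ω.isOpen.mem_nhds (η.tsupport_subset hx))).mul η.contDiff.contDiffAt
  · have h0 : (fun y => g y * η y) =ᶠ[nhds x] fun _ => (0 : ℝ) := by
      filter_upwards [(isClosed_tsupport η).isOpen_compl.mem_nhds hx] with y hy
      rw [image_eq_zero_of_notMem_tsupport hy, mul_zero]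
    exact contDiffAt_const.congr_of_eventuallyEq h0

/-- The product `g η` of a test function with a function that is `C^n` on `Ω`. -/
def mulTestFunction {g : E → ℝ} (hg : ContDiffOn ℝ n g Ω) (η : 𝓓^{n}(Ω, ℝ)) : 𝓓^{n}(Ω, ℝ) where
  toFun x := g x * η x
  contDiff' := contDiff_mul_testFunction hg η
  hasCompactSupport' := η.hasCompactSupport.mul_left
  tsupport_subset' := (tsupport_mul_subset_right (f := g) (g := η)).trans η.tsupport_subset

theorem exists_contDiff_eqOn [FiniteDimensional ℝ E] {g : E → ℝ} (hg : ContDiffOn ℝ n g Ω)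
    {K : Compacts E} (hK : (K : Set E) ⊆ Ω) :
    ∃ h : E → ℝ, ContDiff ℝ n h ∧ ∀ x ∈ K, h x = g x := by
  obtain ⟨χ, h0, h1, -⟩ := exists_contMDiffMap_zero_one_nhds_of_isClosed (n := n)
    (modelWithCornersSelf ℝ E) Ω.isOpen.isClosed_compl K.isCompact.isClosed
    (Set.disjoint_left.2 fun x hx hxK => hx (hK hxK))
  refine ⟨fun x => χ x * g x, ?_, fun x hx => ?_⟩
  · rw [contDiff_iff_contDiffAt]
    intro x
    by_cases hx : x ∈ Ω
    · exact (χ.contMDiff.contDiff.contDiffAt).mul (hg.contDiffAt (Ω.isOpen.mem_nhds hx))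
    · have h0 : (fun y => χ y * g y) =ᶠ[nhds x] fun _ => (0 : ℝ) := by
        filter_upwards [Filter.Eventually.filter_mono (nhds_le_nhdsSet hx) h0] with y hy
        rw [hy, zero_mul]
      exact contDiffAt_const.congr_of_eventuallyEq h0
  · have := (Filter.Eventually.filter_mono (nhds_le_nhdsSet hx) h1).self_of_nhds
    simp [this]

/-- `η ↦ g η` as a continuous linear map on test functions, if `g` is `C^n` on `Ω` (and zero
otherwise). -/
def mulTestCLM [FiniteDimensional ℝ E] (g : E → ℝ) : 𝓓^{n}(Ω, ℝ) →L[ℝ] 𝓓^{n}(Ω, ℝ) :=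
  open scoped Classical in
  if hg : ContDiffOn ℝ n g Ω then
    TestFunction.limitCLM ℝ (mulTestFunction hg)
      (fun _ hK => TestFunction.ofSupportedInCLM ℝ hK ∘L
        ContDiffMapSupportedIn.bilinLeftCLM (ContinuousLinearMap.mul ℝ ℝ)
          (exists_contDiff_eqOn hg hK).choose_spec.1)
      (fun K hK η => by
        ext x
        change g x * η x = η x * (exists_contDiff_eqOn hg hK).choose x
        by_cases hx : x ∈ K
        · rw [(exists_contDiff_eqOn hg hK).choose_spec.2 x hx, mul_comm]
        · have : η x = 0 := η.zero_on_compl hx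
          rw [this, mul_zero, zero_mul])
  else 0

theorem mulTestCLM_apply [FiniteDimensional ℝ E] {g : E → ℝ} (hg : ContDiffOn ℝ n g Ω)
    (η : 𝓓^{n}(Ω, ℝ)) (x : E) : mulTestCLM g η x = g x * η x := by
  rw [mulTestCLM, dif_pos hg]
  rfl

variable {F : Type*} [NormedAddCommGroup F] [NormedSpace ℝ F]

/-- A distribution of order at most `m`, considered as one of order at most `n`, for `m ≤ n`. -/
def raiseOrder (T : 𝓓'^{m}(Ω, F)) : 𝓓'^{n}(Ω, F) :=
  (TestFunction.monoCLM ℝ : 𝓓^{n}(Ω, ℝ) →L[ℝ] 𝓓^{m}(Ω, ℝ)).precompCompactConvergenceCLM F T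

/-- The product `g T` of a distribution with a real function: `(g T)(η) = T(g η)`. -/
def mulRealFun [FiniteDimensional ℝ E] (g : E → ℝ) (T : 𝓓'^{n}(Ω, F)) : 𝓓'^{n}(Ω, F) :=
  (mulTestCLM g : 𝓓^{n}(Ω, ℝ) →L[ℝ] 𝓓^{n}(Ω, ℝ)).precompCompactConvergenceCLM F T

/-- The product `a T` of a distribution with a complex function. -/
def mulFun [FiniteDimensional ℝ E] [NormedSpace ℂ F] (a : E → ℂ) (T : 𝓓'^{n}(Ω, F)) :
    𝓓'^{n}(Ω, F) :=
  mulRealFun (fun x => (a x).re) T + Complex.I • mulRealFun (fun x => (a x).im) T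

/-- The distribution `η ↦ ∫ η f` of a function `f` that is locally integrable on `Ω`. -/
def ofFun [MeasurableSpace E] [BorelSpace E] (Ω : Opens E) (n : ℕ∞) (μ : Measure E)
    (f : E → F) : 𝓓'^{n}(Ω, F) :=
  ContinuousLinearMap.toUniformConvergenceCLM (RingHom.id ℝ) F _
    (TestFunction.integralAgainstBilinCLM (ContinuousLinearMap.lsmul ℝ ℝ) μ f)

theorem raiseOrder_apply (h : m ≤ n) (T : 𝓓'^{m}(Ω, F)) (η : 𝓓^{n}(Ω, ℝ)) (ζ : 𝓓^{m}(Ω, ℝ))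
    (hζ : ∀ x, ζ x = η x) : raiseOrder T η = T ζ := by
  have : ζ = TestFunction.monoCLM ℝ η := by
    ext x
    simp [hζ, h]
  rw [this]
  rfl

theorem mulRealFun_apply [FiniteDimensional ℝ E] (g : E → ℝ) (T : 𝓓'^{n}(Ω, F))
    (η : 𝓓^{n}(Ω, ℝ)) : mulRealFun g T η = T (mulTestCLM g η) := rfl

theorem ofFun_apply [MeasurableSpace E] [BorelSpace E] {μ : Measure E} {f : E → F}
    (hf : LocallyIntegrableOn f Ω μ) (η : 𝓓^{n}(Ω, ℝ)) :
    ofFun Ω n μ f η = ∫ x, η x • f x ∂μ :=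
  TestFunction.integralAgainstBilinCLM_eq_integral hf

end Products

/-! ### The operators on distributions on an open subset of `ℝ³` -/

section Operators

variable {Ω : Opens E3} {n m : ℕ∞}

/-- The Laplacian `∑ₖ ∂ₖ ∂ₖ T` of a distribution. -/
def distLaplacian (T : 𝓓'^{n}(Ω, ℂ)) : 𝓓'(Ω, ℂ) :=
  ∑ k : Fin 3, Distribution.lineDerivCLM (stdVec k)
    (Distribution.lineDerivCLM (stdVec k) T : 𝓓'(Ω, ℂ))

/-- The Schrödinger operator `(-Δ + v) T`, for `v` of class `C^n`. -/
def schrodinger (v : E3 → ℂ) (T : 𝓓'^{n}(Ω, ℂ)) : 𝓓'(Ω, ℂ) :=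
  -distLaplacian T + raiseOrder (mulFun v T)

/-- The Moisil-Theodoresco operator `D T = ∑ₖ iₖ ∂ₖ T` from distributions of order at most `m` to
distributions of order at most `n`, for `m + 1 ≤ n`. -/
def distMT (T : 𝓓'^{m}(Ω, ℍ[ℂ])) : 𝓓'^{n}(Ω, ℍ[ℂ]) :=
  ∑ k : Fin 3, Distribution.mapCLM (mulLeft (unit k)) (Distribution.lineDerivCLM (stdVec k) T)

/-- Left multiplication `α T` of a distribution by a biquaternionic function of class `C^n`. -/
def leftMulFun (α : E3 → ℍ[ℂ]) (T : 𝓓'^{n}(Ω, ℍ[ℂ])) : 𝓓'^{n}(Ω, ℍ[ℂ]) :=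
  mulFun (fun x => (α x).re) T
    + mulFun (fun x => (α x).imI) (Distribution.mapCLM (mulLeft (unit 0)) T)
    + mulFun (fun x => (α x).imJ) (Distribution.mapCLM (mulLeft (unit 1)) T)
    + mulFun (fun x => (α x).imK) (Distribution.mapCLM (mulLeft (unit 2)) T)

/-- Right multiplication `M^α T = T α` of a distribution by a biquaternionic function of class
`C^n`. -/
def rightMulFun (α : E3 → ℍ[ℂ]) (T : 𝓓'^{n}(Ω, ℍ[ℂ])) : 𝓓'^{n}(Ω, ℍ[ℂ]) :=
  mulFun (fun x => (α x).re) T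
    + mulFun (fun x => (α x).imI) (Distribution.mapCLM (mulRight (unit 0)) T)
    + mulFun (fun x => (α x).imJ) (Distribution.mapCLM (mulRight (unit 1)) T)
    + mulFun (fun x => (α x).imK) (Distribution.mapCLM (mulRight (unit 2)) T)

/-- A scalar distribution as a biquaternionic one. -/
def scalarDist (T : 𝓓'^{n}(Ω, ℂ)) : 𝓓'^{n}(Ω, ℍ[ℂ]) := Distribution.mapCLM scalar T

/-- `(D - α) T` for a scalar distribution `T` of order at most `n` and `α` of class `C^{n+1}`; its
order is at most `n + 1`. -/
def darboux (α : E3 → ℍ[ℂ]) (T : 𝓓'^{n}(Ω, ℂ)) : 𝓓'^{n + 1}(Ω, ℍ[ℂ]) :=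
  distMT (scalarDist T) - leftMulFun α (raiseOrder (scalarDist T))

/-- `(D + M^α) T` for a biquaternionic distribution `T` of order at most `n` and `α` of class
`C^n`. -/
def diracRight (α : E3 → ℍ[ℂ]) (T : 𝓓'^{n}(Ω, ℍ[ℂ])) : 𝓓'(Ω, ℍ[ℂ]) :=
  distMT T + raiseOrder (rightMulFun α T)

/-- The complex Dirac distribution at the origin, restricted to `Ω`. -/
def diracDelta (Ω : Opens E3) : 𝓓'(Ω, ℂ) :=
  Distribution.mapCLM Complex.ofRealCLM (Distribution.delta 0)

/-- `T` is a fundamental solution of `-Δ + v` in `Ω`. -/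
def IsSchrodingerFundamentalSolution (v : E3 → ℂ) (T : 𝓓'^{n}(Ω, ℂ)) : Prop :=
  schrodinger v T = diracDelta Ω

/-- `T` is a fundamental solution of `D + M^α` in `Ω`. -/
def IsDiracFundamentalSolution (α : E3 → ℍ[ℂ]) (T : 𝓓'^{n}(Ω, ℍ[ℂ])) : Prop :=
  diracRight α T = scalarDist (diracDelta Ω)

end Operators

end

/-! The first claim is the factorization `(D + M^α)(D - α) = -Δ + v` on scalar distributions. Write
`α = ∑ A_k i_k` and expand. The sum from `D` carries `i_k i_j`, with the left factor from the outer
operator; the sum from `M^α` carries `i_j i_k`, since it multiplies on the right. After the indices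
of the second sum are exchanged, the terms `A_j ∂_k ψ` cancel, and the coefficient of `i_k i_j` is
`∂_k ∂_j ψ - (∂_k A_j) ψ - A_k A_j ψ`. A logarithmic gradient is curl-free, so this is symmetric in
`k, j`; anticommutation of the units leaves only minus the trace, which is `-Δψ + (div A + A·A) ψ`.
Finally `div A + A·A = Δφ/φ`. This is `diracRight_darboux_vec` together with
`fderiv_logDerivComponent`.

For the second claim, replacing `|x|` by `√(|x|² + ε²)` and letting `ε → 0` shows that the classical
gradient of the kernel is its distributional gradient (`integral_fderiv_smul_helmholtzKernel`). In
polar coordinates the weak form of `-Δ - c²` then becomes, on each ray, the integral of an exact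
derivative with boundary value `η(0)/(4π)` (`integral_radial`), and the unit sphere has area `4π`.

The third claim is the first at `n = 0` applied to the second, with `(D - α)ψ` identified as the
explicit function (`darboux_helmholtzKernel`). -/

noncomputable section

/-! ### Calculus of distributions of finite order: products, Leibniz rule, change of order. -/

section Calculus

variable {Ω : Opens E3} {n m k : ℕ∞} {F : Type*} [NormedAddCommGroup F] [NormedSpace ℝ F]

theorem raiseOrder_eq (T : 𝓓'^{m}(Ω, F)) (η : 𝓓^{n}(Ω, ℝ)) :
    raiseOrder T η = T (TestFunction.monoCLM ℝ η) := rfl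

theorem monoCLM_apply_of_le (h : m ≤ n) (η : 𝓓^{n}(Ω, ℝ)) (x : E3) :
    (TestFunction.monoCLM ℝ η : 𝓓^{m}(Ω, ℝ)) x = η x := by
  simp [h]

theorem contDiffOn_re {a : E3 → ℂ} {s : Set E3} (ha : ContDiffOn ℝ n a s) :
    ContDiffOn ℝ n (fun x => (a x).re) s := Complex.reCLM.contDiff.comp_contDiffOn ha

theorem contDiffOn_im {a : E3 → ℂ} {s : Set E3} (ha : ContDiffOn ℝ n a s) :
    ContDiffOn ℝ n (fun x => (a x).im) s := Complex.imCLM.contDiff.comp_contDiffOn ha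

theorem lineDerivCLM_apply_eq_fderiv (h : m + 1 ≤ n) (η : 𝓓^{n}(Ω, ℝ)) (v x : E3) :
    (TestFunction.lineDerivCLM ℝ v η : 𝓓^{m}(Ω, ℝ)) x = fderiv ℝ η x v := by
  rw [TestFunction.lineDerivCLM_eq_fderivCLM, TestFunction.fderivCLM_apply_of_le _ h]

theorem testFunction_apply_eq_zero (η : 𝓓^{n}(Ω, ℝ)) {x : E3} (hx : x ∉ Ω) : η x = 0 :=
  image_eq_zero_of_notMem_tsupport fun h => hx (η.tsupport_subset h)

theorem testFunction_ext {η ζ : 𝓓^{n}(Ω, ℝ)} (h : ∀ x ∈ Ω, η x = ζ x) : η = ζ := by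
  ext x
  by_cases hx : x ∈ Ω
  · exact h x hx
  · rw [testFunction_apply_eq_zero _ hx, testFunction_apply_eq_zero _ hx]

/-- Mixed derivatives of a distribution commute. -/
theorem lineDerivCLM_comm (h1 : n + 1 ≤ m) (h2 : m + 1 ≤ k) (T : 𝓓'^{n}(Ω, F)) (v w : E3) :
    (Distribution.lineDerivCLM v (Distribution.lineDerivCLM w T : 𝓓'^{m}(Ω, F)) : 𝓓'^{k}(Ω, F))
      = Distribution.lineDerivCLM w (Distribution.lineDerivCLM v T : 𝓓'^{m}(Ω, F)) := by
  ext η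
  simp only [Distribution.lineDerivCLM_apply, neg_neg]
  congr 1
  ext x
  -- The two steps `n + 1 ≤ m` and `m + 1 ≤ k` force `2 ≤ k`, just enough for the second derivative
  -- of `η` to be symmetric.
  have hη : ContDiff ℝ 2 η := η.contDiff.of_le (by
    have : (2 : ℕ∞) ≤ k := by
      calc (2 : ℕ∞) = 0 + 1 + 1 := by norm_num
        _ ≤ n + 1 + 1 := by gcongr; exact zero_le
        _ ≤ k := (add_le_add_left h1 1).trans h2
    exact WithTop.coe_le_coe.2 this)
  have key (v w : E3) : (TestFunction.lineDerivCLM ℝ w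
      (TestFunction.lineDerivCLM ℝ v η : 𝓓^{m}(Ω, ℝ)) : 𝓓^{n}(Ω, ℝ)) x
      = fderiv ℝ (fderiv ℝ η) x w v := by
    rw [lineDerivCLM_apply_eq_fderiv h1]
    have : ⇑(TestFunction.lineDerivCLM ℝ v η : 𝓓^{m}(Ω, ℝ)) = fun y => fderiv ℝ η y v := by
      ext y
      exact lineDerivCLM_apply_eq_fderiv h2 η v y
    rw [this, fderiv_clm_apply
      ((hη.fderiv_right (m := 1) (by norm_num)).differentiable (by norm_num) x)
      (differentiableAt_const v)]
    simp
  rw [key, key]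
  exact hη.contDiffAt.isSymmSndFDerivAt (by simp) _ _

variable [NormedSpace ℂ F]

theorem mulFun_apply (a : E3 → ℂ) (T : 𝓓'^{n}(Ω, F)) (η : 𝓓^{n}(Ω, ℝ)) :
    mulFun a T η = T (mulTestCLM (fun x => (a x).re) η)
      + Complex.I • T (mulTestCLM (fun x => (a x).im) η) := rfl

theorem mulFun_mulFun {a b : E3 → ℂ} (ha : ContDiffOn ℝ n a Ω) (hb : ContDiffOn ℝ n b Ω)
    (T : 𝓓'^{n}(Ω, F)) : mulFun a (mulFun b T) = mulFun (fun x => a x * b x) T := by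
  have hab := ha.mul hb
  ext η
  simp only [mulFun_apply]
  have h1 : mulTestCLM (fun x => (a x * b x).re) η
      = mulTestCLM (fun x => (b x).re) (mulTestCLM (fun x => (a x).re) η)
        - mulTestCLM (fun x => (b x).im) (mulTestCLM (fun x => (a x).im) η) := by
    ext x
    rw [mulTestCLM_apply (contDiffOn_re hab)]
    simp only [sub_apply, mulTestCLM_apply (contDiffOn_re ha), mulTestCLM_apply (contDiffOn_im ha), mulTestCLM_apply (contDiffOn_re hb),
      mulTestCLM_apply (contDiffOn_im hb), Complex.mul_re]
    ring
  have h2 : mulTestCLM (fun x => (a x * b x).im) η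
      = mulTestCLM (fun x => (b x).im) (mulTestCLM (fun x => (a x).re) η)
        + mulTestCLM (fun x => (b x).re) (mulTestCLM (fun x => (a x).im) η) := by
    ext x
    rw [mulTestCLM_apply (contDiffOn_im hab)]
    simp only [add_apply, mulTestCLM_apply (contDiffOn_re ha), mulTestCLM_apply (contDiffOn_im ha), mulTestCLM_apply (contDiffOn_re hb),
      mulTestCLM_apply (contDiffOn_im hb), Complex.mul_im]
    ring
  rw [h1, h2, map_sub, map_add]
  simp only [smul_add, smul_smul, Complex.I_mul_I, neg_smul, one_smul]
  abel

theorem mulFun_congr {a b : E3 → ℂ} (h : ∀ x ∈ Ω, a x = b x) (hb : ContDiffOn ℝ n b Ω)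
    (T : 𝓓'^{n}(Ω, F)) : mulFun a T = mulFun b T := by
  -- `mulTestCLM` is zero by default for a function that is not `C^n` on `Ω`, so the regularity of
  -- `a` has to be secured before its values can be used.
  have ha : ContDiffOn ℝ n a Ω := hb.congr h
  ext η
  have hre : mulTestCLM (fun x => (a x).re) η = mulTestCLM (fun x => (b x).re) η :=
    testFunction_ext fun x hx => by
      rw [mulTestCLM_apply (contDiffOn_re ha), mulTestCLM_apply (contDiffOn_re hb), h x hx]
  have him : mulTestCLM (fun x => (a x).im) η = mulTestCLM (fun x => (b x).im) η :=
    testFunction_ext fun x hx => by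
      rw [mulTestCLM_apply (contDiffOn_im ha), mulTestCLM_apply (contDiffOn_im hb), h x hx]
  rw [mulFun_apply, mulFun_apply, hre, him]

theorem mulFun_add {a b : E3 → ℂ} (ha : ContDiffOn ℝ n a Ω) (hb : ContDiffOn ℝ n b Ω)
    (T : 𝓓'^{n}(Ω, F)) : mulFun (fun x => a x + b x) T = mulFun a T + mulFun b T := by
  have hab := ha.add hb
  ext η
  have hre : mulTestCLM (fun x => (a x + b x).re) η
      = mulTestCLM (fun x => (a x).re) η + mulTestCLM (fun x => (b x).re) η := by
    ext x
    rw [mulTestCLM_apply (contDiffOn_re hab), add_apply, mulTestCLM_apply (contDiffOn_re ha),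
      mulTestCLM_apply (contDiffOn_re hb), Complex.add_re, add_mul]
  have him : mulTestCLM (fun x => (a x + b x).im) η
      = mulTestCLM (fun x => (a x).im) η + mulTestCLM (fun x => (b x).im) η := by
    ext x
    rw [mulTestCLM_apply (contDiffOn_im hab), add_apply, mulTestCLM_apply (contDiffOn_im ha),
      mulTestCLM_apply (contDiffOn_im hb), Complex.add_im, add_mul]
  rw [add_apply, mulFun_apply, mulFun_apply, mulFun_apply, hre, him, map_add, map_add, smul_add]
  abel

theorem mulFun_zero (T : 𝓓'^{n}(Ω, F)) : mulFun (fun _ => 0) T = 0 := by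
  have h : (mulTestCLM (fun _ => (0 : ℝ)) : 𝓓^{n}(Ω, ℝ) →L[ℝ] 𝓓^{n}(Ω, ℝ)) = 0 := by
    ext η x
    rw [mulTestCLM_apply contDiffOn_const]
    simp
  ext η
  simp [mulFun_apply, h]

/-- Leibniz rule for the product of a distribution with a function. -/
theorem lineDerivCLM_mulFun {a a' : E3 → ℂ} (h1 : n + 1 ≤ m) (h2 : m + 1 ≤ k)
    (ha : ContDiffOn ℝ m a Ω) (ha' : ContDiffOn ℝ n a' Ω) (v : E3)
    (haa' : ∀ x ∈ Ω, fderiv ℝ a x v = a' x) (T : 𝓓'^{n}(Ω, F)) :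
    (Distribution.lineDerivCLM v (mulFun a (raiseOrder T : 𝓓'^{m}(Ω, F))) : 𝓓'^{k}(Ω, F))
      = raiseOrder (mulFun a' T)
        + raiseOrder (mulFun a (Distribution.lineDerivCLM v T : 𝓓'^{m}(Ω, F))) := by
  have hnm : n ≤ m := le_self_add.trans h1
  have hmk : m ≤ k := le_self_add.trans h2
  have hm : (m : WithTop ℕ∞) ≠ 0 := by
    have : (m : ℕ∞) ≠ 0 := by
      rintro rfl
      simp at h1
    exact mod_cast this
  have hk : (k : WithTop ℕ∞) ≠ 0 := by
    have : (k : ℕ∞) ≠ 0 := by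
      rintro rfl
      simp at h2
    exact mod_cast this
  -- The rule is dual to `∂(gη) = g'η + g ∂η` on test functions. The three terms live naturally in
  -- different orders, since `g'` is only `C^n`; the maps `monoCLM` bring them together.
  have key (g g' : E3 → ℝ) (hg : ContDiffOn ℝ m g Ω) (hg' : ContDiffOn ℝ n g' Ω)
      (hgg' : ∀ x ∈ Ω, fderiv ℝ g x v = g' x) (η : 𝓓^{k}(Ω, ℝ)) :
      (TestFunction.lineDerivCLM ℝ v (mulTestCLM g (TestFunction.monoCLM ℝ η : 𝓓^{m}(Ω, ℝ)))
        : 𝓓^{n}(Ω, ℝ))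
      = mulTestCLM g' (TestFunction.monoCLM ℝ η : 𝓓^{n}(Ω, ℝ))
        + TestFunction.monoCLM ℝ
            (mulTestCLM g (TestFunction.lineDerivCLM ℝ v η : 𝓓^{m}(Ω, ℝ))) := by
    refine testFunction_ext fun x hx => ?_
    have e : ⇑(mulTestCLM g (TestFunction.monoCLM ℝ η : 𝓓^{m}(Ω, ℝ))) = fun y => g y * η y := by
      ext y
      rw [mulTestCLM_apply hg, monoCLM_apply_of_le hmk]
    rw [lineDerivCLM_apply_eq_fderiv h1, e, add_apply, mulTestCLM_apply hg',
      monoCLM_apply_of_le (hnm.trans hmk), monoCLM_apply_of_le hnm, mulTestCLM_apply hg,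
      lineDerivCLM_apply_eq_fderiv h2, ← hgg' x hx,
      fderiv_fun_mul ((hg.contDiffAt (Ω.isOpen.mem_nhds hx)).differentiableAt hm)
        (η.contDiff.differentiable hk x)]
    simp
    ring
  ext η
  simp only [Distribution.lineDerivCLM_apply, mulFun_apply, raiseOrder_eq, add_apply]
  have dre (x) (hx : x ∈ Ω) : fderiv ℝ (fun y => (a y).re) x v = (a' x).re := by
    have := ((ha.contDiffAt (Ω.isOpen.mem_nhds hx)).differentiableAt hm).hasFDerivAt
    have e : fderiv ℝ (fun y => (a y).re) x = Complex.reCLM.comp (fderiv ℝ a x) :=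
      (Complex.reCLM.hasFDerivAt.comp x this).fderiv
    rw [e, ← haa' x hx]
    rfl
  have dim (x) (hx : x ∈ Ω) : fderiv ℝ (fun y => (a y).im) x v = (a' x).im := by
    have := ((ha.contDiffAt (Ω.isOpen.mem_nhds hx)).differentiableAt hm).hasFDerivAt
    have e : fderiv ℝ (fun y => (a y).im) x = Complex.imCLM.comp (fderiv ℝ a x) :=
      (Complex.imCLM.hasFDerivAt.comp x this).fderiv
    rw [e, ← haa' x hx]
    rfl
  have hr := key _ _ (contDiffOn_re ha) (contDiffOn_re ha') dre η
  have hi := key _ _ (contDiffOn_im ha) (contDiffOn_im ha') dim η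
  rw [hr, hi, map_add, map_add]
  module

/-- Order bookkeeping: in the factorization the products `A_j A_k T` arise at order `n + 1`, while
the potential multiplies `T` at order `n`. -/
theorem raiseOrder_mulFun_raiseOrder {a : E3 → ℂ} (h1 : n ≤ m) (h2 : m ≤ k)
    (ha : ContDiffOn ℝ m a Ω) (T : 𝓓'^{n}(Ω, F)) :
    (raiseOrder (mulFun a (raiseOrder T : 𝓓'^{m}(Ω, F))) : 𝓓'^{k}(Ω, F))
      = raiseOrder (mulFun a T) := by
  have ha' : ContDiffOn ℝ n a Ω := ha.of_le (WithTop.coe_le_coe.2 h1)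
  have key (g : E3 → ℝ) (hg : ContDiffOn ℝ m g Ω) (η : 𝓓^{k}(Ω, ℝ)) :
      (TestFunction.monoCLM ℝ (mulTestCLM g (TestFunction.monoCLM ℝ η : 𝓓^{m}(Ω, ℝ)))
        : 𝓓^{n}(Ω, ℝ)) = mulTestCLM g (TestFunction.monoCLM ℝ η) := by
    ext x
    rw [monoCLM_apply_of_le h1, mulTestCLM_apply hg, monoCLM_apply_of_le h2,
      mulTestCLM_apply (hg.of_le (WithTop.coe_le_coe.2 h1)), monoCLM_apply_of_le (h1.trans h2)]
  ext η
  simp only [raiseOrder_eq, mulFun_apply]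
  rw [key _ (contDiffOn_re ha), key _ (contDiffOn_im ha)]

omit [NormedSpace ℂ F] in
-- The intermediate order of a second derivative is immaterial. `distLaplacian` passes through order
-- `∞`, whereas `darboux` stops at order `n + 1`.
theorem lineDerivCLM_lineDerivCLM {n' : ℕ∞} (h1 : n + 1 ≤ m) (h2 : m + 1 ≤ k) (h3 : n + 1 ≤ n')
    (h4 : n' + 1 ≤ k) (T : 𝓓'^{n}(Ω, F)) (v w : E3) :
    (Distribution.lineDerivCLM v (Distribution.lineDerivCLM w T : 𝓓'^{m}(Ω, F)) : 𝓓'^{k}(Ω, F))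
      = Distribution.lineDerivCLM v (Distribution.lineDerivCLM w T : 𝓓'^{n'}(Ω, F)) := by
  ext η
  simp only [Distribution.lineDerivCLM_apply, neg_neg]
  congr 1
  ext x
  rw [lineDerivCLM_apply_eq_fderiv h1, lineDerivCLM_apply_eq_fderiv h3]
  congr 2
  ext y
  rw [lineDerivCLM_apply_eq_fderiv h2, lineDerivCLM_apply_eq_fderiv h4]

end Calculus

/-! ### Biquaternion algebra and the factorization of the Schrödinger operator. -/

section Algebra

open Biquaternion

/-- The biquaternion with given coordinates. -/
def ofCoords (a b c d : ℂ) : ℍ[ℂ] := ⟨a, b, c, d⟩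

theorem ofCoords_mul (a b c d a' b' c' d' : ℂ) :
    ofCoords a b c d * ofCoords a' b' c' d' =
      ofCoords (a * a' - b * b' - c * c' - d * d') (a * b' + b * a' + c * d' - d * c')
        (a * c' - b * d' + c * a' + d * b') (a * d' + b * c' - c * b' + d * a') :=
  Quaternion.ext _ _ (Quaternion.re_mul ..) (Quaternion.imI_mul ..) (Quaternion.imJ_mul ..)
    (Quaternion.imK_mul ..)

theorem ofCoords_add (a b c d a' b' c' d' : ℂ) :
    ofCoords a b c d + ofCoords a' b' c' d' = ofCoords (a + a') (b + b') (c + c') (d + d') := rfl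

theorem ofCoords_neg (a b c d : ℂ) : -ofCoords a b c d = ofCoords (-a) (-b) (-c) (-d) := rfl

theorem ofCoords_smul (z a b c d : ℂ) :
    z • ofCoords a b c d = ofCoords (z * a) (z * b) (z * c) (z * d) := rfl

theorem scalar_eq_ofCoords (z : ℂ) : scalar z = ofCoords z 0 0 0 := rfl

theorem vec_eq_ofCoords (a : Fin 3 → ℂ) : vec a = ofCoords 0 (a 0) (a 1) (a 2) := rfl

/-- Distinct units anticommute, so symmetric off-diagonal coefficients cancel in pairs, and each
unit squares to `-1`. With `s` the second derivatives this is `D² = -Δ`. -/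
theorem sum_unit_mul_unit_mul_scalar {s : Fin 3 → Fin 3 → ℂ} (hs : ∀ j k, s j k = s k j) :
    ∑ k, ∑ j, unit k * (unit j * scalar (s k j)) = -scalar (∑ k, s k k) := by
  simp only [Fin.sum_univ_three, scalar_eq_ofCoords, unit, vec_eq_ofCoords, ofCoords_mul,
    ofCoords_add, ofCoords_neg]
  rw [hs 1 0, hs 2 0, hs 2 1]
  simp
  ring_nf

variable {Ω : Opens E3} {n m k : ℕ∞}

/-- `mulFun` glues real and imaginary parts by `Complex.I`, so a map that is a priori only real
linear must commute with `I`. -/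
theorem mulFun_mapCLM {F G : Type*} [NormedAddCommGroup F] [NormedSpace ℝ F] [NormedSpace ℂ F]
    [NormedAddCommGroup G] [NormedSpace ℝ G] [NormedSpace ℂ G] {L : F →L[ℝ] G}
    (hL : ∀ z, L (Complex.I • z) = Complex.I • L z) (a : E3 → ℂ) (T : 𝓓'^{n}(Ω, F)) :
    mulFun a (Distribution.mapCLM L T) = Distribution.mapCLM L (mulFun a T) := by
  ext η
  simp only [mulFun_apply, Distribution.mapCLM_apply, map_add, hL]

theorem lineDerivCLM_mapCLM {F G : Type*} [NormedAddCommGroup F] [NormedSpace ℝ F]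
    [NormedAddCommGroup G] [NormedSpace ℝ G] (L : F →L[ℝ] G) (v : E3) (T : 𝓓'^{n}(Ω, F)) :
    (Distribution.lineDerivCLM v (Distribution.mapCLM L T) : 𝓓'^{m}(Ω, G))
      = Distribution.mapCLM L (Distribution.lineDerivCLM v T) := by
  ext η
  simp only [Distribution.lineDerivCLM_apply, Distribution.mapCLM_apply, map_neg]

/-- Left multiplication of scalars by a biquaternion. -/
def mulLeftScalar (p : ℍ[ℂ]) : ℂ →L[ℝ] ℍ[ℂ] := (mulLeft p).comp scalar

theorem mulLeftScalar_apply (p : ℍ[ℂ]) (z : ℂ) : mulLeftScalar p z = p * scalar z := rfl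

theorem mulLeftScalar_I_smul (p : ℍ[ℂ]) (z : ℂ) :
    mulLeftScalar p (Complex.I • z) = Complex.I • mulLeftScalar p z := by
  have : scalar (Complex.I • z) = Complex.I • scalar z := map_smul (algebraMapCLM ℂ ℍ[ℂ]) _ _
  rw [mulLeftScalar_apply, mulLeftScalar_apply, this, mul_smul_comm]

theorem mulRight_I_smul (p q : ℍ[ℂ]) :
    mulRight p (Complex.I • q) = Complex.I • mulRight p q :=
  smul_mul_assoc _ _ _

theorem distribution_sum_apply {F ι : Type*} [NormedAddCommGroup F] [NormedSpace ℝ F]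
    (s : Finset ι) (T : ι → 𝓓'^{n}(Ω, F)) (η : 𝓓^{n}(Ω, ℝ)) :
    (∑ i ∈ s, T i) η = ∑ i ∈ s, T i η := by
  simp

theorem leftMulFun_vec_scalarDist (A : Fin 3 → E3 → ℂ) (T : 𝓓'^{n}(Ω, ℂ)) :
    leftMulFun (fun x => vec fun k => A k x) (scalarDist T)
      = ∑ k, Distribution.mapCLM (mulLeftScalar (unit k)) (mulFun (A k) T) := by
  simp_rw [Fin.sum_univ_three, ← mulFun_mapCLM (mulLeftScalar_I_smul _)]
  simp only [leftMulFun]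
  have : mulFun (fun x => (vec fun k => A k x).re) (scalarDist T) = 0 := mulFun_zero _
  rw [this, zero_add]
  rfl

theorem rightMulFun_vec (A : Fin 3 → E3 → ℂ) (T : 𝓓'^{n}(Ω, ℍ[ℂ])) :
    rightMulFun (fun x => vec fun k => A k x) T
      = ∑ k, Distribution.mapCLM (mulRight (unit k)) (mulFun (A k) T) := by
  simp_rw [Fin.sum_univ_three, ← mulFun_mapCLM (mulRight_I_smul _)]
  simp only [rightMulFun]
  have : mulFun (fun x => (vec fun k => A k x).re) T = 0 := mulFun_zero _
  rw [this, zero_add]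
  rfl

/-- With the units pulled out, all the analysis takes place on the scalar distributions `∂_k T - A_k
T`. -/
theorem darboux_vec (A : Fin 3 → E3 → ℂ) (T : 𝓓'^{n}(Ω, ℂ)) :
    darboux (fun x => vec fun k => A k x) T
      = ∑ k, Distribution.mapCLM (mulLeftScalar (unit k))
          (Distribution.lineDerivCLM (stdVec k) T - mulFun (A k) (raiseOrder T)) := by
  have e : (raiseOrder (scalarDist T) : 𝓓'^{n + 1}(Ω, ℍ[ℂ])) = scalarDist (raiseOrder T) := rfl
  simp only [darboux, e, leftMulFun_vec_scalarDist, map_sub, Finset.sum_sub_distrib]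
  congr 1
  refine Finset.sum_congr rfl fun k _ => ?_
  rw [scalarDist, lineDerivCLM_mapCLM]
  rfl

theorem mulFun_distribution_sum {F ι : Type*} [NormedAddCommGroup F] [NormedSpace ℝ F]
    [NormedSpace ℂ F] (s : Finset ι) (a : E3 → ℂ) (T : ι → 𝓓'^{n}(Ω, F)) :
    mulFun a (∑ i ∈ s, T i) = ∑ i ∈ s, mulFun a (T i) := by
  ext η
  simp only [mulFun_apply, distribution_sum_apply, Finset.sum_add_distrib, Finset.smul_sum]

theorem mulFun_distribution_sub {F : Type*} [NormedAddCommGroup F] [NormedSpace ℝ F]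
    [NormedSpace ℂ F] (a : E3 → ℂ) (S T : 𝓓'^{n}(Ω, F)) :
    mulFun a (S - T) = mulFun a S - mulFun a T := by
  ext η
  simp only [mulFun_apply, sub_apply, smul_sub]
  abel

/-- The factorization `(D + M^α)(D - α) = -Δ + v` for vectorial `α` with `curl α = 0` and
`v = div α + α²`. -/
theorem diracRight_darboux_vec {A : Fin 3 → E3 → ℂ} {dA : Fin 3 → Fin 3 → E3 → ℂ} {v : E3 → ℂ}
    (hA : ∀ k, ContDiffOn ℝ (n + 1 : ℕ∞) (A k) Ω) (hdA : ∀ j k, ContDiffOn ℝ n (dA j k) Ω)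
    (hAd : ∀ j k, ∀ x ∈ Ω, fderiv ℝ (A k) x (stdVec j) = dA j k x)
    (hsymm : ∀ j k, ∀ x ∈ Ω, dA j k x = dA k j x)
    (hv : ∀ x ∈ Ω, v x = ∑ k, (dA k k x + A k x * A k x)) (T : 𝓓'^{n}(Ω, ℂ)) :
    diracRight (fun x => vec fun k => A k x) (darboux (fun x => vec fun k => A k x) T)
      = scalarDist (schrodinger v T) := by
  have h1 : n ≤ n + 1 := le_self_add
  have hA' (k) : ContDiffOn ℝ n (A k) Ω := (hA k).of_le (WithTop.coe_le_coe.2 h1)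
  -- Pairing with a fixed `η` turns every term into a complex number indexed by `k, j`, and what
  -- remains is algebra in `ℍ[ℂ]`.
  ext1 η
  let D (k : Fin 3) : 𝓓'^{n + 1}(Ω, ℂ) := Distribution.lineDerivCLM (stdVec k) T
  let P (j : Fin 3) : 𝓓'^{n + 1}(Ω, ℂ) := D j - mulFun (A j) (raiseOrder T)
  let p (k j : Fin 3) : ℂ := (Distribution.lineDerivCLM (stdVec k) (P j) : 𝓓'(Ω, ℂ)) η
  let q (k j : Fin 3) : ℂ := (raiseOrder (mulFun (A k) (P j)) : 𝓓'(Ω, ℂ)) η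
  let X (k j : Fin 3) : ℂ := (Distribution.lineDerivCLM (stdVec k) (D j) : 𝓓'(Ω, ℂ)) η
  let V (k j : Fin 3) : ℂ := (raiseOrder (mulFun (dA k j) T) : 𝓓'(Ω, ℂ)) η
  let W (k j : Fin 3) : ℂ := (raiseOrder (mulFun (fun x => A k x * A j x) T) : 𝓓'(Ω, ℂ)) η
  have lhs : diracRight (fun x => vec fun k => A k x) (darboux (fun x => vec fun k => A k x) T) η
      = ∑ k, ∑ j, unit k * (unit j * scalar (p k j))
        + ∑ k, ∑ j, unit j * scalar (q k j) * unit k := by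
    have e (k : Fin 3) : (raiseOrder (mulFun (A k) (darboux (fun x => vec fun k => A k x) T))
        : 𝓓'(Ω, ℍ[ℂ])) η = ∑ j, unit j * scalar (q k j) := by
      rw [darboux_vec, mulFun_distribution_sum, raiseOrder_eq, distribution_sum_apply]
      refine Finset.sum_congr rfl fun j _ => ?_
      rw [mulFun_mapCLM (mulLeftScalar_I_smul _)]
      rfl
    have e' (k : Fin 3) : (Distribution.lineDerivCLM (stdVec k)
        (darboux (fun x => vec fun k => A k x) T) : 𝓓'(Ω, ℍ[ℂ])) η
        = ∑ j, unit j * scalar (p k j) := by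
      rw [darboux_vec, map_sum, distribution_sum_apply]
      refine Finset.sum_congr rfl fun j _ => ?_
      rw [lineDerivCLM_mapCLM]
      rfl
    simp_rw [← Finset.mul_sum, ← Finset.sum_mul, ← e, ← e']
    rw [diracRight, add_apply, distMT, distribution_sum_apply, rightMulFun_vec, raiseOrder_eq,
      distribution_sum_apply]
    rfl
  -- The indices of `q` are exchanged because `M^α` puts `unit k` on the right. The first-order term
  -- `A_j ∂_k T` occurs in `p k j` and `q j k` with opposite signs.
  have hs (k j : Fin 3) : p k j + q j k = X k j - V k j - W k j := by
    have e1 : (Distribution.lineDerivCLM (stdVec k) (mulFun (A j) (raiseOrder T :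
        𝓓'^{n + 1}(Ω, ℂ))) : 𝓓'(Ω, ℂ)) η = V k j + (raiseOrder (mulFun (A j) (D k)) : 𝓓'(Ω, ℂ)) η :=
      DFunLike.congr_fun (lineDerivCLM_mulFun le_rfl le_top (hA j) (hdA k j) (stdVec k) (hAd k j) T) η
    have e2 : (raiseOrder (mulFun (A j) (mulFun (A k) (raiseOrder T : 𝓓'^{n + 1}(Ω, ℂ))))
        : 𝓓'(Ω, ℂ)) η = W k j := by
      simp only [W]
      rw [mulFun_mulFun (hA j) (hA k), raiseOrder_mulFun_raiseOrder h1 le_top ((hA j).mul (hA k))]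
      simp only [mul_comm]
    have e3 : p k j = X k j - (V k j + (raiseOrder (mulFun (A j) (D k)) : 𝓓'(Ω, ℂ)) η) := by
      rw [← e1]
      simp only [p, P, map_sub]
      rfl
    have e4 : q j k = (raiseOrder (mulFun (A j) (D k)) : 𝓓'(Ω, ℂ)) η - W k j := by
      rw [← e2]
      simp only [q, P, mulFun_distribution_sub]
      rfl
    rw [e3, e4]
    ring
  have rhs : scalarDist (schrodinger v T) η = -scalar (∑ k, (X k k - V k k - W k k)) := by
    have e : mulFun v T = ∑ k, (mulFun (dA k k) T + mulFun (fun x => A k x * A k x) T) := by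
      have hvk (k : Fin 3) : ContDiffOn ℝ n (fun x => dA k k x + A k x * A k x) Ω :=
        (hdA k k).add ((hA' k).mul (hA' k))
      rw [mulFun_congr hv (ContDiffOn.sum fun k _ => hvk k)]
      simp_rw [Fin.sum_univ_three]
      rw [mulFun_add ((hvk 0).add (hvk 1)) (hvk 2), mulFun_add (hvk 0) (hvk 1)]
      simp_rw [mulFun_add (hdA _ _) ((hA' _).mul (hA' _))]
    have e' : schrodinger v T η = -∑ k, (X k k - V k k - W k k) := by
      have h2 : distLaplacian T η = ∑ k, X k k := by
        rw [distLaplacian, distribution_sum_apply]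
        refine Finset.sum_congr rfl fun k _ => ?_
        rw [lineDerivCLM_lineDerivCLM le_top le_top (n' := n + 1) le_rfl le_top]
      have h3 : (raiseOrder (mulFun v T) : 𝓓'(Ω, ℂ)) η = ∑ k, (V k k + W k k) := by
        rw [e, raiseOrder_eq, distribution_sum_apply]
        rfl
      rw [schrodinger, add_apply, neg_apply, h2, h3]
      simp only [Finset.sum_add_distrib, Finset.sum_sub_distrib]
      ring
    rw [← map_neg, ← e']
    rfl
  have hWs (k j) : W k j = W j k := by
    simp only [W]
    simp only [mul_comm]
  have hVs (k j) : V k j = V j k := by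
    simp only [V]
    rw [mulFun_congr (hsymm k j) (hdA j k)]
  have hXs (k j) : X k j = X j k := by
    simp only [X, D]
    rw [lineDerivCLM_comm le_rfl le_top]
  rw [lhs, rhs, ← sum_unit_mul_unit_mul_scalar (s := fun k j => X k j - V k j - W k j)
    fun j k => by rw [hWs, hVs, hXs]]
  -- Exchanging the summations aligns the products of units in both sums; the scalars between them
  -- are central.
  rw [Finset.sum_comm (f := fun k j => unit j * scalar (q k j) * unit k), ← Finset.sum_add_distrib]
  refine Finset.sum_congr rfl fun k _ => ?_
  rw [← Finset.sum_add_distrib]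
  refine Finset.sum_congr rfl fun j _ => ?_
  rw [← hs, map_add, mul_add, mul_add, mul_assoc (unit k) (scalar _)]
  have (z : ℂ) (u : ℍ[ℂ]) : scalar z * u = u * scalar z := Algebra.commutes z u
  rw [this]

end Algebra

/-! ### The logarithmic gradient and the first claim. -/

section LogGrad

open Biquaternion

variable {Ω : Opens E3} {n : ℕ∞} {φ : E3 → ℂ}

/-- The components of `(grad φ) / φ`. -/
def logDerivComponent (φ : E3 → ℂ) (k : Fin 3) (x : E3) : ℂ := (φ x)⁻¹ * fderiv ℝ φ x (stdVec k)

theorem logGrad_eq_vec (φ : E3 → ℂ) :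
    logGrad φ = fun x => vec fun k => logDerivComponent φ k x := by
  ext1 x
  rw [logGrad, gradQ, vec_eq_ofCoords, vec_eq_ofCoords, ofCoords_smul, mul_zero]
  rfl

theorem contDiffOn_logDerivComponent (hφ : ContDiffOn ℝ (n + 1 : ℕ∞) φ Ω) (h0 : ∀ x ∈ Ω, φ x ≠ 0)
    (k : Fin 3) : ContDiffOn ℝ n (logDerivComponent φ k) Ω := by
  have h1 : ContDiffOn ℝ n φ Ω := hφ.of_le (WithTop.coe_le_coe.2 le_self_add)
  exact (h1.inv h0).mul ((hφ.fderiv_of_isOpen Ω.isOpen (m := n) le_rfl).clm_apply contDiffOn_const)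

/-- The right-hand side is symmetric in `j, k`, so `α` is curl-free, and its trace gives the Riccati
identity `div A + A·A = Δφ/φ`. Both hypotheses of the factorization come from here. -/
theorem fderiv_logDerivComponent (hφ : ContDiffOn ℝ 2 φ Ω) (h0 : ∀ x ∈ Ω, φ x ≠ 0) (j k : Fin 3)
    {x : E3} (hx : x ∈ Ω) :
    fderiv ℝ (logDerivComponent φ k) x (stdVec j)
      = (φ x)⁻¹ * fderiv ℝ (fderiv ℝ φ) x (stdVec j) (stdVec k)
        - logDerivComponent φ j x * logDerivComponent φ k x := by
  have hφx : ContDiffAt ℝ 2 φ x := hφ.contDiffAt (Ω.isOpen.mem_nhds hx)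
  have h1 := (hφx.differentiableAt (by norm_num)).hasFDerivAt
  have h2 := ((hφx.fderiv_right (m := 1) (by norm_num)).differentiableAt (by norm_num)).hasFDerivAt
  have h3 : HasFDerivAt (logDerivComponent φ k) _ x :=
    ((hasFDerivAt_inv' (𝕜 := ℝ) (h0 x hx)).comp x h1).mul (h2.clm_apply (hasFDerivAt_const (stdVec k) x))
  rw [h3.fderiv]
  simp [logDerivComponent]
  ring

theorem laplacian_eq_sum_fderiv (φ : E3 → ℂ) (x : E3) :
    Δ φ x = ∑ k, fderiv ℝ (fderiv ℝ φ) x (stdVec k) (stdVec k) := by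
  rw [InnerProductSpace.laplacian_eq_iteratedFDeriv_orthonormalBasis φ
    (EuclideanSpace.basisFun (Fin 3) ℝ)]
  simp [iteratedFDeriv_two_apply, stdVec]

theorem isDiracFundamentalSolution_darboux (hφ : ContDiffOn ℝ (n + 2 : ℕ∞) φ Ω)
    (h0 : ∀ x ∈ Ω, φ x ≠ 0) {ψ : 𝓓'^{n}(Ω, ℂ)}
    (hψ : IsSchrodingerFundamentalSolution (fun x => Δ φ x / φ x) ψ) :
    IsDiracFundamentalSolution (logGrad φ) (darboux (logGrad φ) ψ) := by
  have hφ' : ContDiffOn ℝ (n + 1 + 1 : ℕ∞) φ Ω := by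
    rwa [add_assoc, one_add_one_eq_two]
  have h2 : ContDiffOn ℝ 2 φ Ω := hφ.of_le (WithTop.coe_le_coe.2 (le_add_self (a := (2 : ℕ∞))))
  have hA (k : Fin 3) := contDiffOn_logDerivComponent hφ' h0 k
  rw [IsDiracFundamentalSolution, logGrad_eq_vec, ← hψ]
  refine diracRight_darboux_vec
    (dA := fun j k x => fderiv ℝ (logDerivComponent φ k) x (stdVec j)) hA (fun j k => ?_)
    (fun j k x _ => rfl) (fun j k x hx => ?_) (fun x hx => ?_) ψ
  · exact ((hA k).fderiv_of_isOpen Ω.isOpen (m := n) le_rfl).clm_apply contDiffOn_const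
  · simp only [fderiv_logDerivComponent h2 h0 _ _ hx]
    rw [((h2.contDiffAt (Ω.isOpen.mem_nhds hx)).isSymmSndFDerivAt (by simp)).eq, mul_comm
      (logDerivComponent φ j x)]
  · simp only [fderiv_logDerivComponent h2 h0 _ _ hx, sub_add_cancel, ← Finset.mul_sum,
      ← laplacian_eq_sum_fderiv]
    rw [div_eq_inv_mul]

end LogGrad

/-! ### The Helmholtz kernel: regularization, local integrability, gradient; polar coordinates. -/

section Kernel

open Biquaternion Real Set Filter Topology

/-- `s ↦ e^{ics} / (4πs)`. -/
def radialKernel (c : ℂ) (s : ℝ) : ℂ := Complex.exp (Complex.I * c * s) / (4 * π * s)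

theorem helmholtzKernel_eq (c : ℂ) (x : E3) : helmholtzKernel c x = radialKernel c ‖x‖ := rfl

theorem hasDerivAt_radialKernel (c : ℂ) {s : ℝ} (hs : s ≠ 0) :
    HasDerivAt (radialKernel c) ((Complex.I * c - (s : ℂ)⁻¹) * radialKernel c s) s := by
  have hs' : (s : ℂ) ≠ 0 := mod_cast hs
  have hπ : (π : ℂ) ≠ 0 := mod_cast pi_ne_zero
  have h1 : HasDerivAt (fun s : ℝ => (s : ℂ)) 1 s := Complex.ofRealCLM.hasDerivAt
  have h2 := ((h1.const_mul (Complex.I * c)).cexp).fun_div (h1.const_mul (4 * π : ℂ))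
    (by simp [hs, pi_ne_zero])
  refine h2.congr_deriv ?_
  simp only [radialKernel]
  field_simp

theorem norm_exp_I_mul_le (c : ℂ) {s R : ℝ} (hs : 0 ≤ s) (hR : s ≤ R) :
    ‖Complex.exp (Complex.I * c * s)‖ ≤ exp (‖c‖ * R) := by
  refine (Complex.norm_exp_le_exp_norm _).trans (exp_le_exp.2 ?_)
  rw [norm_mul, norm_mul, Complex.norm_I, one_mul, Complex.norm_of_nonneg hs]
  gcongr

/-- Meant for `r = ‖x‖`, `s = regNorm ε x`, `R = ‖x‖ + 1`: the bound is then uniform in `0 ≤ ε ≤ 1`,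
as dominated convergence requires. -/
theorem norm_radialKernel_le (c : ℂ) {r s R : ℝ} (hr : 0 < r) (hs : r ≤ s) (hR : s ≤ R) :
    ‖radialKernel c s‖ ≤ exp (‖c‖ * R) * r⁻¹ := by
  have hs0 : 0 < s := hr.trans_le hs
  rw [radialKernel, norm_div, div_eq_mul_inv]
  gcongr
  · exact norm_exp_I_mul_le c hs0.le hR
  · rw [norm_mul, norm_mul, Complex.norm_of_nonneg hs0.le, Complex.norm_of_nonneg pi_pos.le,
      Complex.norm_ofNat]
    nlinarith [pi_gt_three]

theorem norm_deriv_radialKernel_le (c : ℂ) {r s R : ℝ} (hr : 0 < r) (hs : r ≤ s) (hR : s ≤ R) :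
    ‖(Complex.I * c - (s : ℂ)⁻¹) * radialKernel c s‖ ≤
      exp (‖c‖ * R) * (‖c‖ * r⁻¹ + r⁻¹ ^ 2) := by
  have hs0 : 0 < s := hr.trans_le hs
  have h1 : ‖Complex.I * c - (s : ℂ)⁻¹‖ ≤ ‖c‖ + r⁻¹ := by
    refine (norm_sub_le _ _).trans ?_
    rw [norm_mul, Complex.norm_I, one_mul, norm_inv, Complex.norm_of_nonneg hs0.le]
    gcongr
  calc _ ≤ (‖c‖ + r⁻¹) * (exp (‖c‖ * R) * r⁻¹) := by
        rw [norm_mul]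
        gcongr
        exact norm_radialKernel_le c hr hs hR
    _ = _ := by ring

/-- The regularized norm `√(|x|² + ε²)`. -/
def regNorm (ε : ℝ) (x : E3) : ℝ := √(‖x‖ ^ 2 + ε ^ 2)

theorem regNorm_zero (x : E3) : regNorm 0 x = ‖x‖ := by simp [regNorm]

theorem norm_le_regNorm (ε : ℝ) (x : E3) : ‖x‖ ≤ regNorm ε x :=
  le_sqrt_of_sq_le (le_add_of_nonneg_right (sq_nonneg ε))

theorem regNorm_le (x : E3) {ε : ℝ} (h0 : 0 ≤ ε) (h1 : ε ≤ 1) : regNorm ε x ≤ ‖x‖ + 1 := by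
  refine sqrt_le_iff.2 ⟨by positivity, ?_⟩
  nlinarith [norm_nonneg x]

theorem regNorm_pos {ε : ℝ} (hε : ε ≠ 0) (x : E3) : 0 < regNorm ε x := by
  unfold regNorm
  positivity

theorem contDiff_regNorm {ε : ℝ} (hε : ε ≠ 0) : ContDiff ℝ 1 (regNorm ε) :=
  ((contDiff_norm_sq ℝ).add contDiff_const).sqrt fun x => by positivity

/-- The condition on `regNorm ε x` covers both `ε ≠ 0` at every point and `ε = 0` off the origin, so
the same formulas serve the regularized and the true kernel. -/
theorem hasFDerivAt_regNorm {ε : ℝ} {x : E3} (h : regNorm ε x ≠ 0) :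
    HasFDerivAt (regNorm ε) ((regNorm ε x)⁻¹ • innerSL ℝ x) x := by
  have h0 : ‖x‖ ^ 2 + ε ^ 2 ≠ 0 := fun h' => h (by simp [regNorm, h'])
  have h1 := (((hasStrictFDerivAt_norm_sq x).hasFDerivAt).add_const (ε ^ 2)).sqrt h0
  refine h1.congr_fderiv ?_
  ext v
  simp [regNorm]
  ring

/-- The derivative in the `k`-th direction of `x ↦ radialKernel c (regNorm ε x)`. -/
def gradKernel (c : ℂ) (ε : ℝ) (k : Fin 3) (x : E3) : ℂ :=
  (Complex.I * c - (regNorm ε x : ℂ)⁻¹) * radialKernel c (regNorm ε x) * (x k / regNorm ε x)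

theorem hasFDerivAt_radialKernel_regNorm (c : ℂ) {ε : ℝ} {x : E3} (h : regNorm ε x ≠ 0) :
    HasFDerivAt (fun y => radialKernel c (regNorm ε y))
      (((regNorm ε x)⁻¹ • innerSL ℝ x).smulRight
        ((Complex.I * c - (regNorm ε x : ℂ)⁻¹) * radialKernel c (regNorm ε x))) x :=
  (hasDerivAt_radialKernel c h).hasFDerivAt.comp x (hasFDerivAt_regNorm h)

theorem fderiv_radialKernel_regNorm (c : ℂ) {ε : ℝ} {x : E3} (h : regNorm ε x ≠ 0) (k : Fin 3) :
    fderiv ℝ (fun y => radialKernel c (regNorm ε y)) x (stdVec k) = gradKernel c ε k x := by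
  rw [(hasFDerivAt_radialKernel_regNorm c h).fderiv]
  simp [gradKernel, stdVec, EuclideanSpace.inner_single_right]
  ring

theorem contDiff_radialKernel_regNorm (c : ℂ) {ε : ℝ} (hε : ε ≠ 0) :
    ContDiff ℝ 1 fun y => radialKernel c (regNorm ε y) := by
  have h : ContDiff ℝ 1 fun y => (regNorm ε y : ℂ) :=
    Complex.ofRealCLM.contDiff.comp (contDiff_regNorm hε)
  simp only [radialKernel, div_eq_mul_inv]
  refine ((contDiff_const.mul h).cexp).mul ((contDiff_const.mul h).inv fun x => ?_)
  have := (regNorm_pos hε x).ne'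
  simp [this, pi_ne_zero]

theorem norm_coord_div_regNorm_le (ε : ℝ) (k : Fin 3) (x : E3) :
    ‖((x k : ℂ) / regNorm ε x)‖ ≤ 1 := by
  rw [norm_div]
  refine div_le_one_of_le₀ ?_ (norm_nonneg _)
  rw [Complex.norm_real, Complex.norm_of_nonneg ((norm_nonneg x).trans (norm_le_regNorm ε x))]
  exact (PiLp.norm_apply_le x k).trans (norm_le_regNorm ε x)

theorem norm_gradKernel_le (c : ℂ) {ε : ℝ} (h0 : 0 ≤ ε) (h1 : ε ≤ 1) (k : Fin 3) {x : E3}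
    (hx : x ≠ 0) :
    ‖gradKernel c ε k x‖ ≤ exp (‖c‖ * (‖x‖ + 1)) * (‖c‖ * ‖x‖⁻¹ + ‖x‖⁻¹ ^ 2) := by
  rw [gradKernel, norm_mul]
  refine (mul_le_of_le_one_right (norm_nonneg _) (norm_coord_div_regNorm_le ε k x)).trans ?_
  exact norm_deriv_radialKernel_le c (norm_pos_iff.2 hx) (norm_le_regNorm ε x) (regNorm_le x h0 h1)

theorem measurable_gradKernel (c : ℂ) (ε : ℝ) (k : Fin 3) : Measurable (gradKernel c ε k) := by
  unfold gradKernel radialKernel regNorm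
  fun_prop

theorem measurable_radialKernel_regNorm (c : ℂ) (ε : ℝ) :
    Measurable fun x => radialKernel c (regNorm ε x) := by
  unfold radialKernel regNorm
  fun_prop

/-- The polar weight `r²` absorbs the singularity: `r² r⁻ᵖ = r²⁻ᵖ` is continuous up to `0`. A ball
about the origin serves as neighbourhood of every point. -/
theorem locallyIntegrable_inv_norm_pow {p : ℕ} (hp : p ≤ 2) :
    LocallyIntegrable (fun x : E3 => ‖x‖⁻¹ ^ p) := by
  intro x
  refine ⟨Metric.ball 0 (‖x‖ + 1), Metric.isOpen_ball.mem_nhds (by simp), ?_⟩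
  rw [integrableOn_fun_norm_addHaar volume (f := fun r : ℝ => r⁻¹ ^ p)]
  refine IntegrableOn.congr_fun (f := fun y : ℝ => y ^ (2 - p)) ?_ (fun y hy => ?_)
    measurableSet_Ioo
  · exact ((continuous_pow _).integrableOn_Icc (a := 0) (b := ‖x‖ + 1)).mono_set Ioo_subset_Icc_self
  · have : y ≠ 0 := hy.1.ne'
    simp only [finrank_euclideanSpace, Fintype.card_fin, smul_eq_mul]
    rw [inv_pow, ← div_eq_mul_inv, pow_sub₀ _ this hp, div_eq_mul_inv]

theorem locallyIntegrable_mul_of_continuous {f g : E3 → ℝ} (hf : Continuous f)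
    (hg : LocallyIntegrable g) : LocallyIntegrable fun x => f x * g x := by
  rw [← locallyIntegrableOn_univ] at hg ⊢
  exact hg.continuousOn_mul hf.continuousOn isOpen_univ.isLocallyClosed

theorem locallyIntegrable_kernelBound (c : ℂ) :
    LocallyIntegrable fun x : E3 => exp (‖c‖ * (‖x‖ + 1)) * ‖x‖⁻¹ := by
  refine locallyIntegrable_mul_of_continuous (by fun_prop) ?_
  simpa using locallyIntegrable_inv_norm_pow (p := 1) (by norm_num)

theorem locallyIntegrable_gradKernelBound (c : ℂ) :
    LocallyIntegrable fun x : E3 => exp (‖c‖ * (‖x‖ + 1)) * (‖c‖ * ‖x‖⁻¹ + ‖x‖⁻¹ ^ 2) := by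
  refine locallyIntegrable_mul_of_continuous (by fun_prop) ?_
  refine LocallyIntegrable.add (locallyIntegrable_mul_of_continuous (by fun_prop) ?_)
    (locallyIntegrable_inv_norm_pow le_rfl)
  simpa using locallyIntegrable_inv_norm_pow (p := 1) (by norm_num)

theorem ae_ne_zero : ∀ᵐ x : E3, x ≠ 0 := by
  simp [ae_iff]

theorem locallyIntegrable_helmholtzKernel (c : ℂ) : LocallyIntegrable (helmholtzKernel c) := by
  refine (locallyIntegrable_kernelBound c).mono ?_ ?_
  · have := measurable_radialKernel_regNorm c 0
    simp only [regNorm_zero] at this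
    exact this.aestronglyMeasurable
  · filter_upwards [ae_ne_zero] with x hx
    rw [norm_of_nonneg (by positivity)]
    exact norm_radialKernel_le c (norm_pos_iff.2 hx) le_rfl (by linarith)

theorem locallyIntegrable_gradKernel (c : ℂ) (k : Fin 3) :
    LocallyIntegrable (gradKernel c 0 k) := by
  refine (locallyIntegrable_gradKernelBound c).mono (measurable_gradKernel c 0 k).aestronglyMeasurable ?_
  filter_upwards [ae_ne_zero] with x hx
  rw [norm_of_nonneg (by positivity)]
  exact norm_gradKernel_le c le_rfl zero_le_one k hx

/-- Dominated convergence as `ε → 0⁺`, stated for a general family because it is applied to the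
regularized kernel and to its derivative. -/
theorem tendsto_integral_smul_of_le {g : E3 → ℝ} (hg : Continuous g) (hc : HasCompactSupport g)
    {K : ℝ → E3 → ℂ} {B : E3 → ℝ} (hB : LocallyIntegrable B) (hm : ∀ ε, Measurable (K ε))
    (hK : ∀ ε, 0 ≤ ε → ε ≤ 1 → ∀ x ≠ 0, ‖K ε x‖ ≤ B x)
    (ht : ∀ x ≠ 0, ContinuousAt (fun ε => K ε x) 0) :
    Tendsto (fun ε => ∫ x, g x • K ε x) (𝓝[>] 0) (𝓝 (∫ x, g x • K 0 x)) := by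
  refine tendsto_integral_filter_of_dominated_convergence (fun x => ‖g x‖ • B x) ?_ ?_
    (hB.integrable_smul_left_of_hasCompactSupport hg.norm hc.norm) ?_
  · exact Eventually.of_forall fun ε =>
      (hg.measurable.smul (hm ε)).aestronglyMeasurable
  · filter_upwards [Ioc_mem_nhdsGT zero_lt_one] with ε hε
    filter_upwards [ae_ne_zero] with x hx
    rw [norm_smul, smul_eq_mul]
    gcongr
    exact hK ε hε.1.le hε.2 x hx
  · filter_upwards [ae_ne_zero] with x hx
    exact (tendsto_const_nhds.smul (ht x hx)).mono_left nhdsWithin_le_nhds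

theorem continuousAt_regNorm (x : E3) : ContinuousAt (fun ε => regNorm ε x) 0 := by
  unfold regNorm
  fun_prop

theorem continuousAt_radialKernel_regNorm (c : ℂ) {x : E3} (hx : x ≠ 0) :
    ContinuousAt (fun ε => radialKernel c (regNorm ε x)) 0 := by
  have h : regNorm 0 x ≠ 0 := by simpa [regNorm_zero]
  exact (hasDerivAt_radialKernel c h).continuousAt.comp (f := fun ε => regNorm ε x)
    (continuousAt_regNorm x)

theorem continuousAt_gradKernel (c : ℂ) (k : Fin 3) {x : E3} (hx : x ≠ 0) :
    ContinuousAt (fun ε => gradKernel c ε k x) 0 := by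
  have h : (regNorm 0 x : ℂ) ≠ 0 := by simpa [regNorm_zero]
  have h1 : ContinuousAt (fun ε => (regNorm ε x : ℂ)) 0 :=
    Complex.continuous_ofReal.continuousAt.comp (f := fun ε => regNorm ε x) (continuousAt_regNorm x)
  exact ((continuousAt_const.sub (h1.inv₀ h)).mul (continuousAt_radialKernel_regNorm c hx)).mul
    (continuousAt_const.div h1 h)

/-- The classical gradient of the Helmholtz kernel is its distributional gradient. -/
theorem integral_fderiv_smul_helmholtzKernel (c : ℂ) {η : E3 → ℝ} (hη : ContDiff ℝ 1 η)
    (hc : HasCompactSupport η) (k : Fin 3) :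
    ∫ x, fderiv ℝ η x (stdVec k) • helmholtzKernel c x = -∫ x, η x • gradKernel c 0 k x := by
  have hη' : Continuous fun x => fderiv ℝ η x (stdVec k) :=
    (hη.continuous_fderiv one_ne_zero).clm_apply continuous_const
  have hc' : HasCompactSupport fun x => fderiv ℝ η x (stdVec k) := hc.fderiv_apply ℝ _
  -- For `ε > 0` the kernel is `C¹` on all of space and integration by parts has no boundary term;
  -- the identity then passes to the limit on both sides.
  have hreg (ε : ℝ) (hε : 0 < ε) :
      ∫ x, fderiv ℝ η x (stdVec k) • radialKernel c (regNorm ε x)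
        = -∫ x, η x • gradKernel c ε k x := by
    have hK := contDiff_radialKernel_regNorm c hε.ne'
    have e : gradKernel c ε k = fun x =>
        fderiv ℝ (fun y => radialKernel c (regNorm ε y)) x (stdVec k) := by
      ext x
      rw [fderiv_radialKernel_regNorm c (regNorm_pos hε.ne' x).ne']
    have hg : Continuous fun x => fderiv ℝ (fun y => radialKernel c (regNorm ε y)) x (stdVec k) :=
      (hK.continuous_fderiv one_ne_zero).clm_apply continuous_const
    rw [e]
    have i1 := hK.continuous.locallyIntegrable (μ := volume)
      |>.integrable_smul_left_of_hasCompactSupport hη' hc'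
    have i2 := hg.locallyIntegrable (μ := volume)
      |>.integrable_smul_left_of_hasCompactSupport hη.continuous hc
    have i3 := hK.continuous.locallyIntegrable (μ := volume)
      |>.integrable_smul_left_of_hasCompactSupport hη.continuous hc
    rw [integral_smul_fderiv_eq_neg_fderiv_smul_of_integrable i1 i2 i3
      (fun x _ => hη.differentiable one_ne_zero x) (fun x _ => hK.differentiable one_ne_zero x),
      neg_neg]
  have t1 := tendsto_integral_smul_of_le hη' hc' (locallyIntegrable_kernelBound c)
    (measurable_radialKernel_regNorm c) (fun ε h0 h1 x hx => norm_radialKernel_le c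
      (norm_pos_iff.2 hx) (norm_le_regNorm ε x) (regNorm_le x h0 h1))
    fun x hx => continuousAt_radialKernel_regNorm c hx
  have t2 := (tendsto_integral_smul_of_le hη.continuous hc (locallyIntegrable_gradKernelBound c)
    (fun ε => measurable_gradKernel c ε k) (fun ε h0 h1 x hx => norm_gradKernel_le c h0 h1 k hx)
    fun x hx => continuousAt_gradKernel c k hx).neg
  simp only [regNorm_zero] at t1
  refine tendsto_nhds_unique (t1.congr' ?_) t2
  filter_upwards [self_mem_nhdsWithin] with ε hε
  exact hreg ε hε

/-- Integration in polar coordinates. -/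
theorem integral_eq_integral_sphere {f : E3 → ℂ} (hf : Integrable f) :
    ∫ x, f x = ∫ z : Metric.sphere (0 : E3) 1, (∫ r in Ioi (0 : ℝ), r ^ 2 • f (r • (z : E3)))
      ∂(volume : Measure E3).toSphere := by
  -- Polar coordinates are a homeomorphism only off the origin, which is a null set; the radial
  -- measure has density `r²`.
  let g : Metric.sphere (0 : E3) 1 × Ioi (0 : ℝ) → ℂ := fun p => f (p.2.1 • p.1.1)
  have hg : g ∘ homeomorphUnitSphereProd E3 = fun x : ({0}ᶜ : Set E3) => f x := by
    ext x
    have : ‖(x : E3)‖ ≠ 0 := norm_ne_zero_iff.2 x.2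
    simp [g, smul_smul, this]
  have hmp := (volume : Measure E3).measurePreserving_homeomorphUnitSphereProd
  have hint : Integrable g ((volume : Measure E3).toSphere.prod
      (.volumeIoiPow (Module.finrank ℝ E3 - 1))) := by
    rw [← hmp.integrable_comp_emb (Homeomorph.measurableEmbedding _), hg]
    exact (integrableOn_iff_comap_subtypeVal (measurableSet_singleton _).compl).1 hf.integrableOn
  calc ∫ x, f x = ∫ x : ({0}ᶜ : Set E3), f x ∂(volume.comap Subtype.val) := by
        rw [integral_subtype_comap (measurableSet_singleton _).compl, restrict_compl_singleton]
    _ = ∫ p, g p ∂((volume : Measure E3).toSphere.prod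
          (.volumeIoiPow (Module.finrank ℝ E3 - 1))) := by
        rw [← hmp.integral_comp (Homeomorph.measurableEmbedding _)]
        exact congrArg (fun h => ∫ x, h x ∂_) hg.symm
    _ = _ := by
        rw [integral_prod _ hint]
        refine integral_congr_ae (Eventually.of_forall fun z => ?_)
        simp only [Measure.volumeIoiPow, ENNReal.ofReal]
        rw [integral_withDensity_eq_integral_smul (by fun_prop),
          integral_subtype_comap measurableSet_Ioi
            fun a => Real.toNNReal (a ^ (Module.finrank ℝ E3 - 1)) • f (a • (z : E3))]
        refine setIntegral_congr_fun measurableSet_Ioi fun a ha => ?_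
        have : (0 : ℝ) ≤ a ^ 2 := by positivity
        simp [NNReal.smul_def, this]

end Kernel

/-! ### The Helmholtz kernel is a fundamental solution. -/

section Fundamental

open Biquaternion Real Set Filter Topology

theorem toSphere_real_univ : (volume : Measure E3).toSphere.real univ = 4 * π := by
  rw [Measure.toSphere_real_apply_univ, measureReal_def, EuclideanSpace.volume_ball_fin_three]
  simp only [ENNReal.ofReal_one, one_pow, one_mul, finrank_euclideanSpace, Fintype.card_fin]
  rw [ENNReal.toReal_ofReal (by positivity)]
  push_cast
  ring

theorem sum_fderiv_stdVec (η : E3 → ℝ) (x v : E3) :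
    ∑ k, fderiv ℝ η x (stdVec k) * v k = fderiv ℝ η x v := by
  conv_rhs => rw [← (EuclideanSpace.basisFun (Fin 3) ℝ).sum_repr v]
  simp [stdVec, mul_comm]

/-- With `K` the radial kernel, `(r²K')' = -c² r²K`, so the integrand is the derivative of `η(rz)
r²K'(r)`. Only the value at `r = 0` survives. -/
theorem integral_radial (c : ℂ) {η : E3 → ℝ} (hη : ContDiff ℝ 1 η) (hc : HasCompactSupport η)
    {z : E3} (hz : ‖z‖ = 1) :
    ∫ r in Ioi (0 : ℝ), r ^ 2 • (∑ k, fderiv ℝ η (r • z) (stdVec k) • gradKernel c 0 k (r • z)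
      - c ^ 2 * (η (r • z) • helmholtzKernel c (r • z))) = η 0 / (4 * π) := by
  -- This is `r²K'(r)`, written so that it is smooth through `r = 0`, where it equals `-1/(4π)`.
  let g : ℝ → ℂ := fun r => (Complex.I * c * r - 1) * Complex.exp (Complex.I * c * r) / (4 * π)
  let H : ℝ → ℂ := fun r => η (r • z) • g r
  have hg (r : ℝ) : HasDerivAt g (-c ^ 2 * r * Complex.exp (Complex.I * c * r) / (4 * π)) r := by
    have h1 : HasDerivAt (fun s : ℝ => (s : ℂ)) 1 r := Complex.ofRealCLM.hasDerivAt
    have h2 := h1.const_mul (Complex.I * c)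
    refine (((h2.sub_const 1).mul h2.cexp).div_const (4 * π : ℂ)).congr_deriv ?_
    have := Complex.I_sq
    linear_combination (c ^ 2 * r * Complex.exp (Complex.I * c * r) / (4 * π)) * this
  have hη' (r : ℝ) : HasDerivAt (fun r : ℝ => η (r • z)) (fderiv ℝ η (r • z) z) r := by
    have h1 : HasDerivAt (fun r : ℝ => r • z) z r := by
      simpa using (hasDerivAt_id r).smul_const z
    exact ((hη.differentiable one_ne_zero) (r • z)).hasFDerivAt.comp_hasDerivAt r h1
  have hH (r : ℝ) : HasDerivAt H (η (r • z) •
      (-c ^ 2 * r * Complex.exp (Complex.I * c * r) / (4 * π)) + fderiv ℝ η (r • z) z • g r) r :=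
    (hη' r).smul (hg r)
  have hz0 : z ≠ 0 := by
    rintro rfl
    simp at hz
  have hcont : ContDiff ℝ 1 H := by
    have hofReal : ContDiff ℝ 1 fun r : ℝ => (r : ℂ) := Complex.ofRealCLM.contDiff
    refine (hη.comp (contDiff_id.smul contDiff_const)).smul (ContDiff.div_const ?_ _)
    exact ((contDiff_const.mul hofReal).sub contDiff_const).mul (contDiff_const.mul hofReal).cexp
  have hsupp : HasCompactSupport H :=
    (hc.comp_isClosedEmbedding (isClosedEmbedding_smul_left hz0)).smul_right
  have key := hsupp.integral_Ioi_deriv_eq hcont 0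
  have : -H 0 = η 0 / (4 * π) := by
    simp [H, g]
    ring
  rw [← this, ← key]
  refine setIntegral_congr_fun measurableSet_Ioi fun r (hr : 0 < r) => ?_
  have hr' : (r : ℂ) ≠ 0 := mod_cast hr.ne'
  have hn : ‖r • z‖ = r := by rw [norm_smul, hz, norm_of_nonneg hr.le, mul_one]
  have hπ : (π : ℂ) ≠ 0 := mod_cast pi_ne_zero
  have hs : ∑ k, fderiv ℝ η (r • z) (stdVec k) • gradKernel c 0 k (r • z)
      = fderiv ℝ η (r • z) z * ((Complex.I * c - (r : ℂ)⁻¹) * radialKernel c r) := by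
    rw [← sum_fderiv_stdVec η _ z, Complex.ofReal_sum, Finset.sum_mul]
    refine Finset.sum_congr rfl fun k _ => ?_
    simp only [gradKernel, regNorm_zero, hn, PiLp.smul_apply, smul_eq_mul, Complex.real_smul,
      Complex.ofReal_mul]
    field_simp
  rw [(hH r).deriv, hs]
  simp only [helmholtzKernel_eq, hn, radialKernel, g, Complex.real_smul]
  push_cast
  field_simp
  ring

theorem integral_gradKernel_sub (c : ℂ) {η : E3 → ℝ} (hη : ContDiff ℝ 1 η)
    (hc : HasCompactSupport η) :
    ∑ k, (∫ x, fderiv ℝ η x (stdVec k) • gradKernel c 0 k x)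
      - c ^ 2 * ∫ x, η x • helmholtzKernel c x = η 0 := by
  have i1 (k : Fin 3) : Integrable fun x => fderiv ℝ η x (stdVec k) • gradKernel c 0 k x :=
    (locallyIntegrable_gradKernel c k).integrable_smul_left_of_hasCompactSupport
      ((hη.continuous_fderiv one_ne_zero).clm_apply continuous_const) (hc.fderiv_apply ℝ _)
  have i2 : Integrable fun x => η x • helmholtzKernel c x :=
    (locallyIntegrable_helmholtzKernel c).integrable_smul_left_of_hasCompactSupport
      hη.continuous hc
  have i3 := integrable_finsetSum Finset.univ fun k _ => i1 k
  have i4 : Integrable fun x => ∑ k, fderiv ℝ η x (stdVec k) • gradKernel c 0 k x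
      - c ^ 2 * (η x • helmholtzKernel c x) := i3.sub (i2.const_mul _)
  rw [← integral_finsetSum _ fun k _ => i1 k, ← integral_const_mul,
    ← integral_sub i3 (i2.const_mul _), integral_eq_integral_sphere i4]
  -- Every ray contributes the same `η(0)/(4π)`, so the sphere integral only multiplies by its area
  -- `4π`.
  have (z : Metric.sphere (0 : E3) 1) := integral_radial c hη hc (norm_eq_of_mem_sphere z)
  simp_rw [this, integral_const, toSphere_real_univ]
  have hπ : (π : ℂ) ≠ 0 := mod_cast pi_ne_zero
  simp
  field_simp

variable {Ω : Opens E3} {n : ℕ∞}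

theorem locallyIntegrableOn_helmholtzKernel (c : ℂ) :
    LocallyIntegrableOn (helmholtzKernel c) Ω volume :=
  (locallyIntegrable_helmholtzKernel c).locallyIntegrableOn _

theorem isSchrodingerFundamentalSolution_helmholtzKernel (c : ℂ) :
    IsSchrodingerFundamentalSolution (fun _ => -c ^ 2) (ofFun Ω n volume (helmholtzKernel c)) := by
  have hli := locallyIntegrableOn_helmholtzKernel (Ω := Ω) c
  rw [IsSchrodingerFundamentalSolution]
  ext η
  have hη : ContDiff ℝ 2 η := η.contDiff.of_le (WithTop.coe_le_coe.2 le_top)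
  -- Only one of the two derivatives is moved back to the kernel: its gradient is locally
  -- integrable, but its second derivatives grow like `|x|⁻³`.
  have hlap (k : Fin 3) : (Distribution.lineDerivCLM (stdVec k) (Distribution.lineDerivCLM
      (stdVec k) (ofFun Ω n volume (helmholtzKernel c)) : 𝓓'(Ω, ℂ)) : 𝓓'(Ω, ℂ)) η
      = -∫ x, fderiv ℝ η x (stdVec k) • gradKernel c 0 k x := by
    have e : ⇑(TestFunction.lineDerivCLM ℝ (stdVec k) η : 𝓓(Ω, ℝ))
        = fun x => fderiv ℝ η x (stdVec k) := by
      ext x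
      exact lineDerivCLM_apply_eq_fderiv le_top η _ x
    rw [← integral_fderiv_smul_helmholtzKernel c
      ((hη.fderiv_right (m := 1) (by norm_num)).clm_apply contDiff_const)
      (η.hasCompactSupport.fderiv_apply ℝ _), Distribution.lineDerivCLM_apply,
      Distribution.lineDerivCLM_apply, neg_neg, ofFun_apply hli]
    simp_rw [lineDerivCLM_apply_eq_fderiv (le_top : n + 1 ≤ ⊤), e]
  have hv : (raiseOrder (mulFun (fun _ => -c ^ 2) (ofFun Ω n volume (helmholtzKernel c)))
      : 𝓓'(Ω, ℂ)) η = -c ^ 2 * ∫ x, η x • helmholtzKernel c x := by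
    rw [raiseOrder_eq, mulFun_apply, ofFun_apply hli, ofFun_apply hli]
    simp_rw [mulTestCLM_apply contDiffOn_const, monoCLM_apply_of_le (le_top : n ≤ ⊤), mul_smul,
      integral_smul, Complex.real_smul, smul_eq_mul]
    rw [← mul_assoc, ← add_mul, mul_comm Complex.I, Complex.re_add_im]
  rw [schrodinger, add_apply, neg_apply, distLaplacian, distribution_sum_apply, hv]
  simp_rw [hlap]
  rw [Finset.sum_neg_distrib, neg_neg, neg_mul, ← sub_eq_add_neg,
    integral_gradKernel_sub c (hη.of_le (by norm_num)) η.hasCompactSupport]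
  rfl

end Fundamental

/-! ### Distributions given by locally integrable functions. -/

section OfFun

variable {Ω : Opens E3} {n m k : ℕ∞} {F G : Type*} [NormedAddCommGroup F] [NormedSpace ℝ F]
  [NormedAddCommGroup G] [NormedSpace ℝ G] {f g : E3 → F}

theorem raiseOrder_ofFun (h : n ≤ m) (hf : LocallyIntegrableOn f Ω) :
    raiseOrder (ofFun Ω n volume f) = ofFun Ω m volume f := by
  ext η
  rw [raiseOrder_eq, ofFun_apply hf, ofFun_apply hf]
  simp_rw [monoCLM_apply_of_le h]

theorem lineDerivCLM_ofFun (h1 : n + 1 ≤ k) (h2 : m + 1 ≤ k) (hf : LocallyIntegrableOn f Ω)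
    (v : E3) : (Distribution.lineDerivCLM v (ofFun Ω n volume f) : 𝓓'^{k}(Ω, F))
      = Distribution.lineDerivCLM v (ofFun Ω m volume f) := by
  ext η
  rw [Distribution.lineDerivCLM_apply, Distribution.lineDerivCLM_apply, ofFun_apply hf,
    ofFun_apply hf]
  simp_rw [lineDerivCLM_apply_eq_fderiv h1, lineDerivCLM_apply_eq_fderiv h2]

theorem integrable_smul_testFunction (hf : LocallyIntegrableOn f Ω) (η : 𝓓^{n}(Ω, ℝ)) :
    Integrable fun x => η x • f x :=
  η.integrable_bilin (ContinuousLinearMap.lsmul ℝ ℝ) hf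

theorem ofFun_sub (hf : LocallyIntegrableOn f Ω) (hg : LocallyIntegrableOn g Ω) :
    ofFun Ω n volume f - ofFun Ω n volume g = ofFun Ω n volume fun x => f x - g x := by
  have hfg : LocallyIntegrableOn (fun x => f x - g x) Ω := hf.sub hg
  ext η
  rw [sub_apply, ofFun_apply hf, ofFun_apply hg, ofFun_apply hfg,
    ← integral_sub (integrable_smul_testFunction hf η) (integrable_smul_testFunction hg η)]
  simp_rw [smul_sub]

theorem ofFun_add (hf : LocallyIntegrableOn f Ω) (hg : LocallyIntegrableOn g Ω) :
    ofFun Ω n volume f + ofFun Ω n volume g = ofFun Ω n volume fun x => f x + g x := by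
  have hfg : LocallyIntegrableOn (fun x => f x + g x) Ω := hf.add hg
  ext η
  rw [add_apply, ofFun_apply hf, ofFun_apply hg, ofFun_apply hfg,
    ← integral_add (integrable_smul_testFunction hf η) (integrable_smul_testFunction hg η)]
  simp_rw [smul_add]

theorem mapCLM_ofFun [CompleteSpace F] [CompleteSpace G] (L : F →L[ℝ] G)
    (hf : LocallyIntegrableOn f Ω) :
    Distribution.mapCLM L (ofFun Ω n volume f) = ofFun Ω n volume fun x => L (f x) := by
  have hLf : LocallyIntegrableOn (fun x => L (f x)) Ω := L.locallyIntegrableOn_comp hf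
  ext η
  rw [Distribution.mapCLM_apply, ofFun_apply hf, ofFun_apply hLf,
    ← L.integral_comp_comm (integrable_smul_testFunction hf η)]
  simp_rw [map_smul]

theorem mulFun_ofFun [NormedSpace ℂ F] [IsScalarTower ℝ ℂ F] {a : E3 → ℂ} (ha : ContDiffOn ℝ n a Ω)
    (hf : LocallyIntegrableOn f Ω) :
    mulFun a (ofFun Ω n volume f) = ofFun Ω n volume fun x => a x • f x := by
  have haf : LocallyIntegrableOn (fun x => a x • f x) Ω :=
    hf.continuousOn_smul Ω.isOpen.isLocallyClosed ha.continuousOn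
  ext η
  have h1 := integrable_smul_testFunction hf (mulTestCLM (fun x => (a x).re) η)
  have h2 : Integrable fun x => Complex.I • mulTestCLM (fun x => (a x).im) η x • f x :=
    (integrable_smul_testFunction hf _).smul Complex.I
  rw [mulFun_apply, ofFun_apply hf, ofFun_apply hf, ofFun_apply haf, ← integral_smul,
    ← integral_add h1 h2]
  refine integral_congr_ae (Filter.Eventually.of_forall fun x => ?_)
  have h (r : ℝ) (y : F) : r • y = (r : ℂ) • y := (algebraMap_smul ℂ r y).symm
  simp only [mulTestCLM_apply (contDiffOn_re ha), mulTestCLM_apply (contDiffOn_im ha), h,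
    smul_smul, ← add_smul]
  congr 1
  nth_rw 3 [← Complex.re_add_im (a x)]
  push_cast
  ring

end OfFun

/-! ### The explicit solution for a constant potential. -/

section Explicit

open Biquaternion

variable {Ω : Opens E3} {φ : E3 → ℂ}

/-- The common form behind the pointwise and the distributional identity. It holds at the origin
too, where division by zero makes `helmholtzKernel` and `gradKernel` vanish. -/
theorem explicitKernel_eq_sum (c : ℂ) (φ : E3 → ℂ) (x : E3) :
    explicitKernel c φ x = ∑ k, mulLeftScalar (unit k)
      (gradKernel c 0 k x - logDerivComponent φ k x • helmholtzKernel c x) := by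
  rw [explicitKernel, logGrad_eq_vec]
  simp only [sub_eq_add_neg, mulLeftScalar_apply, posQ, gradKernel, regNorm_zero,
    ← helmholtzKernel_eq,
    Fin.sum_univ_three, scalar_eq_ofCoords, unit, vec_eq_ofCoords, ofCoords_mul,
    ofCoords_add, ofCoords_neg, ofCoords_smul]
  congr 1 <;> simp <;> ring

theorem differentiableAt_helmholtzKernel (c : ℂ) {x : E3} (hx : x ≠ 0) :
    DifferentiableAt ℝ (helmholtzKernel c) x := by
  have h : regNorm 0 x ≠ 0 := by simpa [regNorm_zero]
  have := (hasFDerivAt_radialKernel_regNorm c h).differentiableAt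
  simp only [regNorm_zero] at this
  exact this

theorem fderiv_helmholtzKernel (c : ℂ) {x : E3} (hx : x ≠ 0) (k : Fin 3) :
    fderiv ℝ (helmholtzKernel c) x (stdVec k) = gradKernel c 0 k x := by
  have h : regNorm 0 x ≠ 0 := by simpa [regNorm_zero]
  have := fderiv_radialKernel_regNorm c h k
  simp only [regNorm_zero] at this
  exact this

theorem moisilTheodoresco_sub_logGrad_mul (c : ℂ) (φ : E3 → ℂ) {x : E3} (hx : x ≠ 0) :
    moisilTheodoresco (fun y => scalar (helmholtzKernel c y)) x
      - logGrad φ x * scalar (helmholtzKernel c x) = explicitKernel c φ x := by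
  have h : fderiv ℝ (fun y => scalar (helmholtzKernel c y)) x
      = scalar.comp (fderiv ℝ (helmholtzKernel c) x) :=
    (scalar.hasFDerivAt.comp x (differentiableAt_helmholtzKernel c hx).hasFDerivAt).fderiv
  rw [explicitKernel_eq_sum, moisilTheodoresco, logGrad_eq_vec, h]
  simp only [ContinuousLinearMap.comp_apply, fderiv_helmholtzKernel c hx]
  simp only [sub_eq_add_neg, mulLeftScalar_apply,
    Fin.sum_univ_three, scalar_eq_ofCoords, unit, vec_eq_ofCoords, ofCoords_mul,
    ofCoords_add, ofCoords_neg]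
  congr 1 <;> simp

theorem locallyIntegrableOn_component (c : ℂ) (hφ : ContDiffOn ℝ 2 φ Ω) (h0 : ∀ x ∈ Ω, φ x ≠ 0)
    (k : Fin 3) : LocallyIntegrableOn
      (fun x => logDerivComponent φ k x • helmholtzKernel c x) Ω :=
  (locallyIntegrableOn_helmholtzKernel c).continuousOn_smul Ω.isOpen.isLocallyClosed
    (contDiffOn_logDerivComponent (n := 1) (by simpa [one_add_one_eq_two] using hφ) h0 k).continuousOn

theorem lineDerivCLM_ofFun_helmholtzKernel (c : ℂ) {n m : ℕ∞} (h : n + 1 ≤ m) (k : Fin 3) :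
    (Distribution.lineDerivCLM (stdVec k) (ofFun Ω n volume (helmholtzKernel c)) : 𝓓'^{m}(Ω, ℂ))
      = ofFun Ω m volume (gradKernel c 0 k) := by
  ext η
  have hη : ContDiff ℝ 1 η := η.contDiff.of_le (WithTop.coe_le_coe.2 (le_add_self.trans h))
  rw [Distribution.lineDerivCLM_apply, ofFun_apply (locallyIntegrableOn_helmholtzKernel c),
    ofFun_apply ((locallyIntegrable_gradKernel c k).locallyIntegrableOn _), neg_eq_iff_eq_neg,
    ← integral_fderiv_smul_helmholtzKernel c hη η.hasCompactSupport k]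
  simp_rw [lineDerivCLM_apply_eq_fderiv h]

theorem darboux_helmholtzKernel (c : ℂ) (hφ : ContDiffOn ℝ 2 φ Ω) (h0 : ∀ x ∈ Ω, φ x ≠ 0) :
    LocallyIntegrableOn (explicitKernel c φ) Ω ∧
    darboux (logGrad φ) (ofFun Ω 0 volume (helmholtzKernel c))
      = ofFun Ω (0 + 1) volume (explicitKernel c φ) := by
  have hA (k : Fin 3) : ContDiffOn ℝ (0 + 1 : ℕ∞) (logDerivComponent φ k) Ω :=
    contDiffOn_logDerivComponent (by simpa [one_add_one_eq_two] using hφ) h0 k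
  have l1 (k : Fin 3) : LocallyIntegrableOn (gradKernel c 0 k) Ω :=
    (locallyIntegrable_gradKernel c k).locallyIntegrableOn _
  have l2 := locallyIntegrableOn_component c hφ h0
  have l3 (k : Fin 3) : LocallyIntegrableOn (fun x => mulLeftScalar (unit k)
      (gradKernel c 0 k x - logDerivComponent φ k x • helmholtzKernel c x)) Ω :=
    (mulLeftScalar (unit k)).locallyIntegrableOn_comp ((l1 k).sub (l2 k))
  have e : explicitKernel c φ = fun x => mulLeftScalar (unit 0)
      (gradKernel c 0 0 x - logDerivComponent φ 0 x • helmholtzKernel c x) + mulLeftScalar (unit 1)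
      (gradKernel c 0 1 x - logDerivComponent φ 1 x • helmholtzKernel c x) + mulLeftScalar (unit 2)
      (gradKernel c 0 2 x - logDerivComponent φ 2 x • helmholtzKernel c x) := by
    ext1 x
    rw [explicitKernel_eq_sum, Fin.sum_univ_three]
  have l01 : LocallyIntegrableOn (fun x => mulLeftScalar (unit 0)
      (gradKernel c 0 0 x - logDerivComponent φ 0 x • helmholtzKernel c x) + mulLeftScalar (unit 1)
      (gradKernel c 0 1 x - logDerivComponent φ 1 x • helmholtzKernel c x)) Ω := (l3 0).add (l3 1)
  refine ⟨?_, ?_⟩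
  · rw [e]
    exact l01.add (l3 2)
  · have hk (k : Fin 3) := mapCLM_ofFun (n := 0 + 1) (mulLeftScalar (unit k)) ((l1 k).sub (l2 k))
    rw [logGrad_eq_vec, darboux_vec, raiseOrder_ofFun le_self_add
      (locallyIntegrableOn_helmholtzKernel c)]
    simp_rw [lineDerivCLM_ofFun_helmholtzKernel c (le_refl (0 + 1 : ℕ∞)),
      mulFun_ofFun (hA _) (locallyIntegrableOn_helmholtzKernel c), ofFun_sub (l1 _) (l2 _)]
    rw [Fin.sum_univ_three, e, ← ofFun_add l01 (l3 2), ← ofFun_add (l3 0) (l3 1)]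
    exact congrArg₂ _ (congrArg₂ _ (hk 0) (hk 1)) (hk 2)

/-- `darboux` yields order `0 + 1`, while the explicit function is a distribution of order `0`; for
a locally integrable function the declared order does not affect the result. -/
theorem diracRight_ofFun {n m : ℕ∞} (hnm : n ≤ m) {A : Fin 3 → E3 → ℂ}
    (hA : ∀ k, ContDiffOn ℝ m (A k) Ω) {f : E3 → ℍ[ℂ]} (hf : LocallyIntegrableOn f Ω) :
    diracRight (fun x => vec fun k => A k x) (ofFun Ω n volume f)
      = diracRight (fun x => vec fun k => A k x) (ofFun Ω m volume f) := by
  have hA' (k) : ContDiffOn ℝ n (A k) Ω := (hA k).of_le (WithTop.coe_le_coe.2 hnm)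
  have haf (k : Fin 3) : LocallyIntegrableOn (fun x => A k x • f x) Ω :=
    hf.continuousOn_smul Ω.isOpen.isLocallyClosed (hA k).continuousOn
  have e (k : Fin 3) : (raiseOrder (mulFun (A k) (ofFun Ω n volume f)) : 𝓓'(Ω, ℍ[ℂ]))
      = raiseOrder (mulFun (A k) (ofFun Ω m volume f)) := by
    rw [mulFun_ofFun (hA' k) hf, mulFun_ofFun (hA k) hf, raiseOrder_ofFun le_top (haf k),
      raiseOrder_ofFun le_top (haf k)]
  have e1 : (distMT (ofFun Ω n volume f) : 𝓓'(Ω, ℍ[ℂ])) = distMT (ofFun Ω m volume f) := by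
    rw [distMT, distMT]
    refine Finset.sum_congr rfl fun k _ => ?_
    rw [lineDerivCLM_ofFun (m := m) le_top le_top hf]
  have e2 : (raiseOrder (rightMulFun (fun x => vec fun k => A k x) (ofFun Ω n volume f))
      : 𝓓'(Ω, ℍ[ℂ])) = raiseOrder (rightMulFun (fun x => vec fun k => A k x)
        (ofFun Ω m volume f)) := by
    ext1 η
    rw [rightMulFun_vec, rightMulFun_vec, raiseOrder_eq, raiseOrder_eq, distribution_sum_apply,
      distribution_sum_apply]
    refine Finset.sum_congr rfl fun k _ => ?_
    rw [Distribution.mapCLM_apply, Distribution.mapCLM_apply, ← raiseOrder_eq, ← raiseOrder_eq, e]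
  rw [diracRight, diracRight, e1, e2]

theorem schrodinger_congr {n : ℕ∞} {v w : E3 → ℂ} (h : ∀ x ∈ Ω, v x = w x)
    (hw : ContDiffOn ℝ n w Ω) (T : 𝓓'^{n}(Ω, ℂ)) : schrodinger v T = schrodinger w T := by
  rw [schrodinger, schrodinger, mulFun_congr h hw]

end Explicit
end

theorem mainTheorem3 (Ω : Opens E3) :
    -- if `ψ` is a fundamental solution of `-Δ + v`, `v = Δφ/φ`, then `(D - α) ψ` is a fundamental
    -- solution of `D + M^α`, `α = (grad φ)/φ`
    (∀ (n : ℕ∞) (φ : E3 → ℂ), ContDiffOn ℝ (n + 2 : ℕ∞) φ Ω → (∀ x ∈ Ω, φ x ≠ 0) →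
      ∀ ψ : 𝓓'^{n}(Ω, ℂ),
        IsSchrodingerFundamentalSolution (fun x => Δ φ x / φ x) ψ →
        IsDiracFundamentalSolution (logGrad φ) (darboux (logGrad φ) ψ)) ∧
    -- `e^{ic|x|} / (4π|x|)` is a fundamental solution of `-Δ - c²`
    (∀ c : ℂ, LocallyIntegrableOn (helmholtzKernel c) Ω volume ∧
      IsSchrodingerFundamentalSolution (fun _ => -c ^ 2) (ofFun Ω 0 volume (helmholtzKernel c))) ∧
    (∀ (c : ℂ) (φ : E3 → ℂ), ContDiffOn ℝ 2 φ Ω → (∀ x ∈ Ω, φ x ≠ 0) →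
      (∀ x ∈ Ω, Δ φ x / φ x = -c ^ 2) →
        -- `(D - α) ψ` has the explicit form, pointwise and in the sense of distributions
        (∀ x ∈ Ω, x ≠ 0 → DifferentiableAt ℝ (helmholtzKernel c) x ∧
          moisilTheodoresco (fun y => Biquaternion.scalar (helmholtzKernel c y)) x
            - logGrad φ x * Biquaternion.scalar (helmholtzKernel c x) = explicitKernel c φ x) ∧
        LocallyIntegrableOn (explicitKernel c φ) Ω volume ∧
        darboux (logGrad φ) (ofFun Ω 0 volume (helmholtzKernel c))
          = ofFun Ω (0 + 1) volume (explicitKernel c φ) ∧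
        -- and it is a fundamental solution of `D + M^α`
        IsDiracFundamentalSolution (logGrad φ) (ofFun Ω 0 volume (explicitKernel c φ))) := by
  refine ⟨fun n φ hφ h0 ψ hψ => isDiracFundamentalSolution_darboux hφ h0 hψ, fun c =>
    ⟨locallyIntegrableOn_helmholtzKernel c, isSchrodingerFundamentalSolution_helmholtzKernel c⟩,
    fun c φ hφ h0 hv => ?_⟩
  obtain ⟨hint, hdarboux⟩ := darboux_helmholtzKernel c hφ h0
  refine ⟨fun x _ hx => ⟨differentiableAt_helmholtzKernel c hx,
    moisilTheodoresco_sub_logGrad_mul c φ hx⟩, hint, hdarboux, ?_⟩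
  have hψ : IsSchrodingerFundamentalSolution (fun x => Δ φ x / φ x)
      (ofFun Ω 0 volume (helmholtzKernel c)) := by
    -- The operator depends on the potential only through its values on `Ω`, where it is the
    -- constant `-c²`.
    rw [IsSchrodingerFundamentalSolution, schrodinger_congr hv contDiffOn_const]
    exact isSchrodingerFundamentalSolution_helmholtzKernel c
  have key := isDiracFundamentalSolution_darboux (by simpa using hφ) h0 hψ
  rw [hdarboux] at key
  rw [IsDiracFundamentalSolution] at key ⊢
  rw [← key, logGrad_eq_vec]
  -- For `φ` of class `C²` the components of `α` are `C¹`, exactly what comparing the orders `0` and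
  -- `0 + 1` requires.
  exact diracRight_ofFun (m := 0 + 1) le_self_add (fun k => contDiffOn_logDerivComponent
    (by simpa [one_add_one_eq_two] using hφ) h0 k) hint
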